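/- **Setting.** Let $\mathcal X,\mathcal S,\mathcal T,\mathcal Z$ be standard Borel spaces (for example finite sets or $\mathbb R$). Fix probability distributions $P_X$ on $\mathcal X$ and $P_S$ on $\mathcal S$, and a channel $P_{T|XS}$ from $\mathcal X\times\mathcal S$ to $\mathcal T$. The codeword $X^n$ is i.i.d. from $P_X$, the state sequence $S^n$ is i.i.d. from $P_S$ and independent of $X^n$, and the echo $T^n$ is the output of the stationary memoryless channel $P_{T|XS}^n$, so that the triples $(X_i,S_i,T_i)$ are i.i.d. with law $P_XP_SP_{T|XS}$. Let $d:\mathcal S\times\mathcal Z\to[0,\infty]$ be a measurable distortion measure with $\mathbb E[d(S,z_0)]<\infty$ for some $z_0\in\mathcal Z$ (for example, a bounded one), and put $d(s^n,z^n)=\frac1n\sum_{i=1}^n d(s_i,z_i)$. **Estimators.** An estimator of block length $n$ with $K$ indices is a pair of random mappings: the first produces an index $w\in\{1,\dots,K\}$ from $(X^n,T^n)$, the second produces $Z^n\in\mathcal Z^n$ from $w$ and the codeword $X^n$, which is known throughout the estimator. Let $K^\star(n,D)$ be the least $K$ for which there is an estimator of block length $n$ with $K$ indices and $\mathbb E[d(S^n,Z^n)]\le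 D$ ($K^\star(n,D)=\infty$ if there is none). Let also $R_{\mathrm{as}}(D)$ be the infimum of $\limsup_{n\to\infty}\frac1n\log K_n$ over all sequences of estimators, of block lengths $n=0,1,2,\dots$ and with $K_n$ indices, that satisfy $\limsup_{n\to\infty}\mathbb E[d(S^n,Z^n)]\le D$. **Single-letter rate.** For $D\ge 0$ let $$R_I(D)=\inf_{P_{Z|XT}:\ \mathbb E[d(S,Z)]\le D} I(T;Z|X)\in[0,\infty],$$ where $(X,S,T,Z)$ has law $P_XP_SP_{T|XS}P_{Z|XT}$ and $\inf\emptyset=\infty$, and let $D_{\min}=\inf\{D\ge0: R_I(D)<\infty\}$. (If $\mathcal X,\mathcal T,\mathcal Z$ are finite, $D_{\min}$ is just the least value of $\mathbb E[d(S,Z)]$ over all $P_{Z|XT}$.) **Theorem.** For every real $D\ge 0$ with $D\neq D_{\min}$, the limit defining the estimation rate-distortion function $R(D)=\lim_{n\to\infty}\frac1n\log K^\star(n,D)$ exists in $[0,\infty]$, and $$R(D)=R_{\mathrm{as}}(D)=\inf_{P_{Z|XT}:\ \mathbb E[d(S,Z)]\le D} I(T;Z|X).$$ If $\mathcal X,\mathcal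 T,\mathcal Z$ are finite, then $R_{\mathrm{as}}(D)=R_I(D)$ also for $D=D_{\min}$. -/

import Mathlib

open MeasureTheory ProbabilityTheory Filter Topology
open scoped ENNReal NNReal

noncomputable section

namespace StateSensing

variable {𝒳 𝒮 𝒯 𝒵 : Type*} [MeasurableSpace 𝒳] [MeasurableSpace 𝒮] [MeasurableSpace 𝒯]
  [MeasurableSpace 𝒵]

/-- The law of one triple `(X, S, T)`: `X ∼ P_X` and `S ∼ P_S` are independent and `T` is the
output of the channel `W = P_{T|XS}` for the input `(X, S)`. -/
def letterLaw (PX : Measure 𝒳) (PS : Measure 𝒮) (W : Kernel (𝒳 × 𝒮) 𝒯) :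
    Measure (𝒳 × 𝒮 × 𝒯) :=
  ((PX.prod PS) ⊗ₘ W).map (fun q => (q.1.1, q.1.2, q.2))

/-- The law of `(Xᵢ, Sᵢ, Tᵢ)`, `i < n`, when `Xⁿ` and `Sⁿ` are i.i.d. and independent, and are
sent through the stationary memoryless channel `W`: the triples are i.i.d. -/
def blockLaw (PX : Measure 𝒳) (PS : Measure 𝒮) (W : Kernel (𝒳 × 𝒮) 𝒯) (n : ℕ) :
    Measure (Fin n → 𝒳 × 𝒮 × 𝒯) :=
  Measure.pi fun _ => letterLaw PX PS W

/-! ### Operational quantities -/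

variable (𝒳 𝒯 𝒵) in
/-- A (randomized) state estimator of block length `n` which describes the echo by one of `K`
indices: the first map produces the index from `(xⁿ, tⁿ)`, the second one the reconstruction `zⁿ`
from the index. The codeword `xⁿ` is available throughout the estimator. -/
structure Estimator (n K : ℕ) where
  /-- `(xⁿ, tⁿ) ↦ w` -/
  enc : Kernel ((Fin n → 𝒳) × (Fin n → 𝒯)) (Fin K)
  /-- `(xⁿ, w) ↦ zⁿ` -/
  dec : Kernel ((Fin n → 𝒳) × Fin K) (Fin n → 𝒵)
  markov_enc : IsMarkovKernel enc
  markov_dec : IsMarkovKernel dec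

/-- The per-letter distortion `d(sⁿ, zⁿ) = (1/n) ∑ᵢ d(sᵢ, zᵢ)`. -/
def blockDistortion (d : 𝒮 → 𝒵 → ℝ≥0∞) {n : ℕ} (s : Fin n → 𝒮) (z : Fin n → 𝒵) : ℝ≥0∞ :=
  (∑ i, d (s i) (z i)) / n

/-- The expected distortion `E[d(Sⁿ, Zⁿ)]` of an estimator. -/
def Estimator.distortion {n K : ℕ} (h : Estimator 𝒳 𝒯 𝒵 n K) (PX : Measure 𝒳) (PS : Measure 𝒮)
    (W : Kernel (𝒳 × 𝒮) 𝒯) (d : 𝒮 → 𝒵 → ℝ≥0∞) : ℝ≥0∞ :=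
  ∫⁻ p, ∫⁻ w, ∫⁻ z, blockDistortion d (fun i => (p i).2.1) z
      ∂(h.dec (fun i => (p i).1, w))
    ∂(h.enc (fun i => (p i).1, fun i => (p i).2.2))
    ∂(blockLaw PX PS W n)

/-- `K⋆(n, D)`: the least `K` for which some estimator with block length `n` and `K` indices has
expected distortion at most `D` (`⊤` if there is none). -/
def minIndices (PX : Measure 𝒳) (PS : Measure 𝒮) (W : Kernel (𝒳 × 𝒮) 𝒯) (d : 𝒮 → 𝒵 → ℝ≥0∞)
    (n : ℕ) (D : ℝ≥0∞) : ℕ∞ :=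
  ⨅ (K : ℕ) (_ : ∃ h : Estimator 𝒳 𝒯 𝒵 n K, h.distortion PX PS W d ≤ D), (K : ℕ∞)

/-- `(1/n) log K`, in nats. -/
def indexRate (n : ℕ) (K : ℕ∞) : EReal :=
  ENNReal.log (K : ℝ≥0∞) / (n : EReal)

/-- The least asymptotic rate `limsup (1/n) log Kₙ` of a sequence of estimators whose expected
distortions satisfy the constraint `D` in the limit. -/
def asymptoticRate (PX : Measure 𝒳) (PS : Measure 𝒮) (W : Kernel (𝒳 × 𝒮) 𝒯)
    (d : 𝒮 → 𝒵 → ℝ≥0∞) (D : ℝ≥0∞) : EReal :=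
  sInf {r | ∃ (K : ℕ → ℕ) (h : ∀ n, Estimator 𝒳 𝒯 𝒵 n (K n)),
    limsup (fun n => (h n).distortion PX PS W d) atTop ≤ D ∧
    r = limsup (fun n => indexRate n (K n)) atTop}

/-! ### Single-letter quantities -/

/-- The channel `P_{T|X}` obtained by averaging `W` over the state. -/
def echoKernel (PS : Measure 𝒮) (W : Kernel (𝒳 × 𝒮) 𝒯) : Kernel 𝒳 𝒯 :=
  W ∘ₖ (Kernel.id ×ₖ Kernel.const 𝒳 PS)

/-- The channel `P_{Z|X}` induced by `P_{T|X}` and `Q = P_{Z|XT}`. -/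
def reconKernel (PS : Measure 𝒮) (W : Kernel (𝒳 × 𝒮) 𝒯) (Q : Kernel (𝒳 × 𝒯) 𝒵) :
    Kernel 𝒳 𝒵 :=
  Q ∘ₖ (Kernel.id ×ₖ echoKernel PS W)

/-- The conditional mutual information `I(T; Z | X) = D(P_{Z|XT} ‖ P_{Z|X} | P_{XT})`, in nats,
when `P_{Z|XT} = Q`. -/
def condMutualInfo (PX : Measure 𝒳) (PS : Measure 𝒮) (W : Kernel (𝒳 × 𝒮) 𝒯)
    (Q : Kernel (𝒳 × 𝒯) 𝒵) : ℝ≥0∞ :=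
  InformationTheory.klDiv ((PX ⊗ₘ echoKernel PS W) ⊗ₘ Q)
    ((PX ⊗ₘ echoKernel PS W) ⊗ₘ Kernel.prodMkRight 𝒯 (reconKernel PS W Q))

/-- The expected distortion `E[d(S, Z)]` when `P_{Z|XT} = Q`. -/
def letterDistortion (PX : Measure 𝒳) (PS : Measure 𝒮) (W : Kernel (𝒳 × 𝒮) 𝒯)
    (d : 𝒮 → 𝒵 → ℝ≥0∞) (Q : Kernel (𝒳 × 𝒯) 𝒵) : ℝ≥0∞ :=
  ∫⁻ p, ∫⁻ z, d p.2.1 z ∂(Q (p.1, p.2.2)) ∂(letterLaw PX PS W)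

/-- The infimum of `I(T; Z | X)` over all `P_{Z|XT}` with `E[d(S, Z)] ≤ D` (`⊤` if there is
none). -/
def infoRate (PX : Measure 𝒳) (PS : Measure 𝒮) (W : Kernel (𝒳 × 𝒮) 𝒯)
    (d : 𝒮 → 𝒵 → ℝ≥0∞) (D : ℝ≥0∞) : ℝ≥0∞ :=
  ⨅ (Q : Kernel (𝒳 × 𝒯) 𝒵) (_ : IsMarkovKernel Q) (_ : letterDistortion PX PS W d Q ≤ D),
    condMutualInfo PX PS W Q

/-- The smallest distortion level that a finite rate allows. -/
def minDistortion (PX : Measure 𝒳) (PS : Measure 𝒮) (W : Kernel (𝒳 × 𝒮) 𝒯)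
    (d : 𝒮 → 𝒵 → ℝ≥0∞) : ℝ≥0∞ :=
  sInf {D | infoRate PX PS W d D ≠ ⊤}

end StateSensing

end

/-! # The rate-distortion function of state sensing with side information

Write `m` for the law of one pair `(X, T)` and `E` for the channel `P_{T|X}`. The estimator does not
see the state, so `d` can be replaced by `E[d(S, z) | X, T]` (`echoDistortion`), both for one letter
(`letterDistortion_eq`) and for blocks (`Estimator.distortion_eq`). What remains is a rate-distortion
problem for `T` with side information `X` at both ends. All quantities are functionals of the joint
law of `((X, T), Z)`; in particular `I(T; Z | X)` is the divergence of that law from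
`P_{XZ} ⊗ P_{T|X}` (`condMutualInfo_eq`), in which the second factor is fixed.

*Converse* (`Estimator.infoRate_distortion_le`). An estimator with `K` indices induces a law of
`((Xⁿ, Tⁿ), Zⁿ)`; its average over the positions is a competitor in the single-letter problem with
the same distortion. Let `g` be the density of the average with respect to `P_{XZ} ⊗ P_{T|X}`. As
each index has conditional probability at most one, the joint law is dominated by the measure of mass
`K` in which all indices have weight one, and under that measure the `Tᵢ` are independent given
`(Xⁿ, Zⁿ)`. Hence `E[∏ᵢ g(Xᵢ, Zᵢ, Tᵢ)] ≤ K`, and Jensen's inequality gives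
`n I(T; Z | X) = E[∑ᵢ log g(Xᵢ, Zᵢ, Tᵢ)] ≤ log K`. This performs the reduction to one letter and the
convexity argument in one step. The chain rule for the divergence shows that the information is
finite (`Estimator.echoInfo_averageLaw_ne_top`).

*Achievability* (`exists_estimator_seq`). Codewords are drawn from `P_{Z|X}`, given `Xⁿ`, and the
encoder looks for one that is typical. Writing the channels as functions of independent noise turns
the codebooks into points of a product space, so that a good deterministic one exists
(`exists_codebook`). The law of large numbers makes the failure probability vanish at every rate
above `I(T; Z | X)`, and the integrability of `d(S, z₀)` controls the distortion upon failure.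

*Continuity.* Joint convexity of the divergence makes the single-letter rate convex, hence continuous
above `D_min` (`exists_lt_infoRate_lt`, `infoRate_le_of_forall_add`), while it is infinite below.
For finite alphabets it is right continuous at `D_min` too, by compactness and lower semicontinuity
(`infoRate_le_of_forall_add_of_finite`).
-/

noncomputable section

namespace StateSensing

/-! ### Product measures -/

section ProductMeasures

variable {α β : Type*} [MeasurableSpace α] [MeasurableSpace β] {n : ℕ}

lemma lintegral_pi_prod (μ : Fin n → Measure α) [∀ i, IsProbabilityMeasure (μ i)]
    {f : Fin n → α → ℝ≥0∞} (hf : ∀ i, Measurable (f i)) :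
    ∫⁻ a, ∏ i, f i (a i) ∂(Measure.pi μ) = ∏ i, ∫⁻ x, f i x ∂(μ i) := by
  have hind : iIndepFun (fun i (ω : Fin n → α) => f i (ω i)) (Measure.pi μ) :=
    iIndepFun_pi (fun i => (hf i).aemeasurable)
  rw [lintegral_prod_eq_prod_lintegral_of_indepFun Finset.univ _ hind
    (fun i => (hf i).comp (measurable_pi_apply i))]
  refine Finset.prod_congr rfl fun i _ => ?_
  exact (measurePreserving_eval μ i).lintegral_comp (hf i)

lemma lintegral_pi_eval (μ : Fin n → Measure α) [∀ i, IsProbabilityMeasure (μ i)] (i : Fin n)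
    {f : α → ℝ≥0∞} (hf : Measurable f) :
    ∫⁻ a, f (a i) ∂(Measure.pi μ) = ∫⁻ x, f x ∂(μ i) :=
  (measurePreserving_eval μ i).lintegral_comp hf

lemma pi_withDensity (μ : Measure α) [IsProbabilityMeasure μ] {g : α → ℝ≥0∞}
    (hg : Measurable g) [IsProbabilityMeasure (μ.withDensity g)] :
    Measure.pi (fun _ : Fin n => μ.withDensity g) =
      (Measure.pi fun _ : Fin n => μ).withDensity fun a => ∏ i, g (a i) := by
  refine (Measure.pi_eq fun s hs => ?_)
  rw [withDensity_apply _ (MeasurableSet.univ_pi hs), ← lintegral_indicator (MeasurableSet.univ_pi hs)]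
  have : ∀ a : Fin n → α, (Set.univ.pi s).indicator (fun a => ∏ i, g (a i)) a
      = ∏ i, (s i).indicator g (a i) := by
    intro a
    by_cases h : a ∈ Set.univ.pi s
    · rw [Set.indicator_of_mem h]
      exact Finset.prod_congr rfl fun i _ => (Set.indicator_of_mem (h i trivial) _).symm
    · rw [Set.indicator_of_notMem h]
      simp only [Set.mem_pi, Set.mem_univ, true_imp_iff, not_forall] at h
      obtain ⟨i, hi⟩ := h
      exact (Finset.prod_eq_zero (Finset.mem_univ i) (Set.indicator_of_notMem hi _)).symm
  simp_rw [this]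
  rw [lintegral_pi_prod (fun _ => μ) (fun i => hg.indicator (hs i))]
  refine Finset.prod_congr rfl fun i _ => ?_
  rw [lintegral_indicator (hs i), withDensity_apply _ (hs i)]

/-- Functional representation of a memoryless channel: if `f a` pushes Lebesgue measure on the unit
interval to `κ a` for every `a`, then block samples of `μ ⊗ₘ κ` are obtained by feeding i.i.d. noise
to `f`, independently of the input block. -/
lemma lintegral_pi_compProd (μ : Measure α) [IsProbabilityMeasure μ] (κ : Kernel α β)
    [IsMarkovKernel κ] {f : α → unitInterval → β} (hf : Measurable (Function.uncurry f))
    (hfκ : ∀ a, volume.map (f a) = κ a) {F : (Fin n → α × β) → ℝ≥0∞} (hF : Measurable F) :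
    ∫⁻ p, F p ∂(Measure.pi fun _ : Fin n => μ ⊗ₘ κ) =
      ∫⁻ a, ∫⁻ u, F (fun i => (a i, f (a i) (u i))) ∂(Measure.pi fun _ : Fin n => volume)
        ∂(Measure.pi fun _ : Fin n => μ) := by
  have hφ : Measurable (fun q : α × unitInterval => (q.1, f q.1 q.2)) :=
    measurable_fst.prodMk hf
  have h1 : (μ.prod volume).map (fun q : α × unitInterval => (q.1, f q.1 q.2)) = μ ⊗ₘ κ := by
    refine Measure.ext_of_lintegral _ fun G hG => ?_
    rw [lintegral_map hG hφ, lintegral_prod (fun q => G (q.1, f q.1 q.2)) (hG.comp hφ).aemeasurable,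
      Measure.lintegral_compProd hG]
    refine lintegral_congr fun a => ?_
    have hfa : Measurable (f a) := hf.comp (by fun_prop : Measurable fun u => (a, u))
    rw [← hfκ a, lintegral_map (by fun_prop) hfa]
  have h2 : (Measure.pi fun _ : Fin n => μ ⊗ₘ κ) =
      (Measure.pi fun _ : Fin n => μ.prod (volume : Measure unitInterval)).map
        (fun x i => ((x i).1, f (x i).1 (x i).2)) := by
    have : ∀ i : Fin n, SigmaFinite ((μ.prod (volume : Measure unitInterval)).map
      (fun q : α × unitInterval => (q.1, f q.1 q.2))) := fun _ => by rw [h1]; infer_instance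
    have h := Measure.pi_map_pi (μ := fun _ : Fin n => μ.prod (volume : Measure unitInterval))
      (f := fun _ (q : α × unitInterval) => (q.1, f q.1 q.2)) (fun _ => hφ.aemeasurable)
    rw [h, h1]
  have hφn : Measurable (fun (x : Fin n → α × unitInterval) i => ((x i).1, f (x i).1 (x i).2)) :=
    measurable_pi_lambda _ fun i => hφ.comp (measurable_pi_apply i)
  rw [h2, lintegral_map hF hφn]
  have h3 := measurePreserving_arrowProdEquivProdArrow α unitInterval (Fin n) (fun _ => μ)
    (fun _ => volume)
  have hG : Measurable fun q : (Fin n → α) × (Fin n → unitInterval) =>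
      F (fun i => (q.1 i, f (q.1 i) (q.2 i))) := by
    refine hF.comp (measurable_pi_lambda _ fun i => ?_)
    exact hφ.comp (by fun_prop : Measurable fun q : (Fin n → α) × (Fin n → unitInterval) =>
      (q.1 i, q.2 i))
  have h4 := h3.lintegral_comp hG
  rw [lintegral_prod _ hG.aemeasurable] at h4
  exact h4

/-- Weak law of large numbers, one-sided, in terms of the finite products. -/
lemma tendsto_pi_measure_sum_gt (μ : Measure α) [IsProbabilityMeasure μ] {Y : α → ℝ}
    (hY : Measurable Y) (hYi : Integrable Y μ) {c : ℝ} (hc : ∫ a, Y a ∂μ < c) :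
    Tendsto (fun n : ℕ => (Measure.pi fun _ : Fin n => μ) {p | n * c < ∑ i, Y (p i)}) atTop
      (𝓝 0) := by
  set P := Measure.infinitePi (fun _ : ℕ => μ)
  have hev : ∀ i : ℕ, MeasurePreserving (fun ω : ℕ → α => ω i) P μ :=
    fun i => measurePreserving_eval_infinitePi (fun _ => μ) i
  have hY' : ∀ i, Measurable fun ω : ℕ → α => Y (ω i) := fun i => hY.comp (measurable_pi_apply i)
  have hslln := strong_law_ae_real (μ := P) (fun i ω => Y (ω i))
    ((hev 0).integrable_comp_of_integrable hYi)
    (fun i j hij => (iIndepFun_infinitePi (P := fun _ : ℕ => μ) (X := fun _ => Y)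
      (fun _ => hY)).indepFun hij)
    (fun i => ⟨(hY' i).aemeasurable, (hY' 0).aemeasurable, by
      have e : ∀ i, P.map (fun ω => Y (ω i)) = μ.map Y := fun i => by
        rw [← (hev i).map_eq, Measure.map_map hY (hev i).measurable]; rfl
      rw [e, e]⟩)
  have hint : ∫ ω, Y (ω 0) ∂P = ∫ a, Y a ∂μ := by
    rw [← (hev 0).map_eq, integral_map (hev 0).measurable.aemeasurable hY.aestronglyMeasurable]
  have hmap : ∀ n : ℕ, P.map (fun (ω : ℕ → α) (i : Fin n) => ω i) = Measure.pi fun _ : Fin n => μ :=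
    fun n => by
      rw [← Measure.infinitePi_eq_pi]
      exact Measure.map_infinitePi_infinitePi_of_inj (P := fun _ : ℕ => μ)
        (f := fun i : Fin n => (i : ℕ)) Fin.val_injective
  have hme : ∀ n : ℕ, MeasurableSet {ω : ℕ → α | n * c < ∑ i ∈ Finset.range n, Y (ω i)} := fun n =>
    measurableSet_lt measurable_const (Finset.measurable_sum _ fun i _ => hY' i)
  have heq : ∀ n : ℕ, (Measure.pi fun _ : Fin n => μ) {p | n * c < ∑ i, Y (p i)} =
      P {ω | n * c < ∑ i ∈ Finset.range n, Y (ω i)} := fun n => by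
    rw [← hmap n, Measure.map_apply (by fun_prop)]
    · congr 1 with ω
      simp [Finset.sum_range]
    · exact measurableSet_lt measurable_const
        (Finset.measurable_sum _ fun i _ => hY.comp (measurable_pi_apply i))
  simp_rw [heq]
  have hlim : ∀ᵐ ω ∂P, ∀ᶠ n : ℕ in atTop, ω ∉ {ω : ℕ → α | n * c < ∑ i ∈ Finset.range n, Y (ω i)} := by
    filter_upwards [hslln] with ω hω
    have h1 : ∀ᶠ n : ℕ in atTop, (∑ i ∈ Finset.range n, Y (ω i)) / n < c :=
      hω.eventually_lt_const (by rw [hint]; exact hc)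
    filter_upwards [h1, eventually_gt_atTop 0] with n hn hn0
    have hn0' : (0 : ℝ) < n := by exact_mod_cast hn0
    rw [div_lt_iff₀ hn0'] at hn
    refine not_lt.2 ?_
    linarith
  have := tendsto_measure_of_ae_tendsto_indicator (μ := P) atTop (A := ∅)
    (As := fun n : ℕ => {ω : ℕ → α | n * c < ∑ i ∈ Finset.range n, Y (ω i)})
    MeasurableSet.empty hme MeasurableSet.univ (by simp) (by simp)
    (by filter_upwards [hlim] with ω hω; filter_upwards [hω] with n hn; simpa using hn)
  simpa using this

end ProductMeasures

/-! ### Kullback-Leibler divergence -/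

section Divergence

open InformationTheory

variable {α β : Type*} [MeasurableSpace α] [MeasurableSpace β]

/-- Jensen's inequality for the logarithm, in the form `E[Y] ≤ log E[exp Y]`. -/
lemma integral_le_log_of_lintegral_exp_le {μ : Measure α} [IsProbabilityMeasure μ] {Y : α → ℝ}
    (hY : Integrable Y μ) {c : ℝ} (hc : 0 < c)
    (h : ∫⁻ a, ENNReal.ofReal (Real.exp (Y a)) ∂μ ≤ ENNReal.ofReal c) :
    ∫ a, Y a ∂μ ≤ Real.log c := by
  have hexp : Integrable (fun a => Real.exp (Y a)) μ := by
    refine ⟨Real.continuous_exp.comp_aestronglyMeasurable hY.1, ?_⟩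
    rw [hasFiniteIntegral_iff_ofReal (ae_of_all _ fun a => (Real.exp_pos _).le)]
    exact h.trans_lt ENNReal.ofReal_lt_top
  have h1 : ∫ a, Real.exp (Y a) ∂μ ≤ c := by
    rw [integral_eq_lintegral_of_nonneg_ae (ae_of_all _ fun a => (Real.exp_pos _).le) hexp.1]
    exact ENNReal.toReal_le_of_le_ofReal hc.le h
  -- the tangent of `exp` at `log c`
  have h2 : ∀ a, Y a ≤ Real.exp (Y a) / c + (Real.log c - 1) := fun a => by
    have := Real.add_one_le_exp (Y a - Real.log c)
    rw [Real.exp_sub, Real.exp_log hc] at this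
    linarith
  calc ∫ a, Y a ∂μ ≤ ∫ a, (Real.exp (Y a) / c + (Real.log c - 1)) ∂μ :=
        integral_mono hY ((hexp.div_const c).add (integrable_const _)) h2
    _ = (∫ a, Real.exp (Y a) ∂μ) / c + (Real.log c - 1) := by
        rw [integral_add (hexp.div_const c) (integrable_const _), integral_div]; simp
    _ ≤ c / c + (Real.log c - 1) := by gcongr
    _ = Real.log c := by rw [div_self hc.ne']; ring

lemma klDiv_withDensity (ν : Measure α) [IsFiniteMeasure ν] {f : α → ℝ≥0∞} (hf : Measurable f)
    [IsFiniteMeasure (ν.withDensity f)] :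
    klDiv (ν.withDensity f) ν = ∫⁻ a, ENNReal.ofReal (klFun (f a).toReal) ∂ν := by
  rw [klDiv_eq_lintegral_klFun_of_ac (withDensity_absolutelyContinuous _ _)]
  refine lintegral_congr_ae ?_
  filter_upwards [Measure.rnDeriv_withDensity ν hf] with a ha
  rw [ha]

/-- Joint convexity of the Kullback-Leibler divergence. -/
lemma klDiv_convex (μ₁ μ₂ ν₁ ν₂ : Measure α) [IsFiniteMeasure μ₁] [IsFiniteMeasure μ₂]
    [IsFiniteMeasure ν₁] [IsFiniteMeasure ν₂] {a b : ℝ≥0} (ha : a ≠ 0) (hb : b ≠ 0) :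
    klDiv (a • μ₁ + b • μ₂) (a • ν₁ + b • ν₂) ≤ a * klDiv μ₁ ν₁ + b * klDiv μ₂ ν₂ := by
  by_cases h₁ : μ₁ ≪ ν₁
  swap; · simp [klDiv_of_not_ac h₁, ENNReal.mul_top, ha]
  by_cases h₂ : μ₂ ≪ ν₂
  swap; · simp [klDiv_of_not_ac h₂, ENNReal.mul_top, hb]
  set ν := a • ν₁ + b • ν₂ with hν
  have hac₁ : ν₁ ≪ ν := by
    refine Measure.AbsolutelyContinuous.mk fun s _ hs => ?_
    have : a • ν₁ s + b • ν₂ s = 0 := by simpa [hν] using hs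
    simpa [ENNReal.smul_def, ha] using (add_eq_zero.1 this).1
  have hac₂ : ν₂ ≪ ν := by
    refine Measure.AbsolutelyContinuous.mk fun s _ hs => ?_
    have : a • ν₁ s + b • ν₂ s = 0 := by simpa [hν] using hs
    simpa [ENNReal.smul_def, hb] using (add_eq_zero.1 this).2
  set k₁ := ν₁.rnDeriv ν
  set k₂ := ν₂.rnDeriv ν
  set f₁ := μ₁.rnDeriv ν₁
  set f₂ := μ₂.rnDeriv ν₂
  have mk₁ : Measurable k₁ := Measure.measurable_rnDeriv _ _
  have mk₂ : Measurable k₂ := Measure.measurable_rnDeriv _ _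
  have mf₁ : Measurable f₁ := Measure.measurable_rnDeriv _ _
  have mf₂ : Measurable f₂ := Measure.measurable_rnDeriv _ _
  have eν₁ : ν₁ = ν.withDensity k₁ := (Measure.withDensity_rnDeriv_eq _ _ hac₁).symm
  have eν₂ : ν₂ = ν.withDensity k₂ := (Measure.withDensity_rnDeriv_eq _ _ hac₂).symm
  have eμ₁ : μ₁ = ν.withDensity (k₁ * f₁) := by
    rw [withDensity_mul _ mk₁ mf₁, ← eν₁]; exact (Measure.withDensity_rnDeriv_eq _ _ h₁).symm
  have eμ₂ : μ₂ = ν.withDensity (k₂ * f₂) := by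
    rw [withDensity_mul _ mk₂ mf₂, ← eν₂]; exact (Measure.withDensity_rnDeriv_eq _ _ h₂).symm
  have hsum : ∀ᵐ x ∂ν, (a : ℝ≥0∞) * k₁ x + b * k₂ x = 1 := by
    have : ν.withDensity (fun x => (a : ℝ≥0∞) * k₁ x + b * k₂ x) = ν.withDensity 1 := by
      rw [withDensity_one]
      change ν.withDensity ((fun x => (a : ℝ≥0∞) * k₁ x) + (fun x => b * k₂ x)) = ν
      rw [withDensity_add_left (by fun_prop)]
      change ν.withDensity ((a : ℝ≥0∞) • k₁) + ν.withDensity ((b : ℝ≥0∞) • k₂) = ν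
      rw [withDensity_smul _ mk₁, withDensity_smul _ mk₂, ← eν₁, ← eν₂, hν]
      rfl
    exact (withDensity_eq_iff_of_sigmaFinite (by fun_prop) (by fun_prop)).1 this
  set F : α → ℝ≥0∞ := fun x => a * (k₁ x * f₁ x) + b * (k₂ x * f₂ x) with hF
  have mF : Measurable F := by fun_prop
  have eμ : a • μ₁ + b • μ₂ = ν.withDensity F := by
    change _ = ν.withDensity ((fun x => (a : ℝ≥0∞) * (k₁ x * f₁ x)) + (fun x => b * (k₂ x * f₂ x)))
    rw [withDensity_add_left (by fun_prop)]
    change _ = ν.withDensity ((a : ℝ≥0∞) • (k₁ * f₁)) + ν.withDensity ((b : ℝ≥0∞) • (k₂ * f₂))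
    rw [withDensity_smul _ (by fun_prop), withDensity_smul _ (by fun_prop), ← eμ₁, ← eμ₂]
    rfl
  have : IsFiniteMeasure (ν.withDensity F) := eμ ▸ inferInstance
  rw [eμ, klDiv_withDensity ν mF, klDiv_eq_lintegral_klFun_of_ac h₁,
    klDiv_eq_lintegral_klFun_of_ac h₂]
  have mG : ∀ f : α → ℝ≥0∞, Measurable f →
      Measurable fun x => ENNReal.ofReal (klFun (f x).toReal) := fun f hf =>
    ENNReal.measurable_ofReal.comp (measurable_klFun.comp hf.ennreal_toReal)
  have e₁ : ∫⁻ x, ENNReal.ofReal (klFun (f₁ x).toReal) ∂ν₁ =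
      ∫⁻ x, k₁ x * ENNReal.ofReal (klFun (f₁ x).toReal) ∂ν := by
    conv_lhs => rw [eν₁]
    exact lintegral_withDensity_eq_lintegral_mul _ mk₁ (mG _ mf₁)
  have e₂ : ∫⁻ x, ENNReal.ofReal (klFun (f₂ x).toReal) ∂ν₂ =
      ∫⁻ x, k₂ x * ENNReal.ofReal (klFun (f₂ x).toReal) ∂ν := by
    conv_lhs => rw [eν₂]
    exact lintegral_withDensity_eq_lintegral_mul _ mk₂ (mG _ mf₂)
  have m₁ : Measurable fun x => k₁ x * ENNReal.ofReal (klFun (f₁ x).toReal) := mk₁.mul (mG _ mf₁)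
  have m₂ : Measurable fun x => k₂ x * ENNReal.ofReal (klFun (f₂ x).toReal) := mk₂.mul (mG _ mf₂)
  rw [e₁, e₂, ← lintegral_const_mul _ m₁, ← lintegral_const_mul _ m₂,
    ← lintegral_add_left (m₁.const_mul _)]
  have t₁ : ∀ᵐ x ∂ν, k₁ x * f₁ x < ⊤ := by
    refine ae_lt_top (by fun_prop) ?_
    have := measure_ne_top μ₁ Set.univ
    rwa [eμ₁, withDensity_apply _ MeasurableSet.univ, Measure.restrict_univ] at this
  have t₂ : ∀ᵐ x ∂ν, k₂ x * f₂ x < ⊤ := by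
    refine ae_lt_top (by fun_prop) ?_
    have := measure_ne_top μ₂ Set.univ
    rwa [eμ₂, withDensity_apply _ MeasurableSet.univ, Measure.restrict_univ] at this
  refine lintegral_mono_ae ?_
  filter_upwards [hsum, t₁, t₂, Measure.rnDeriv_lt_top ν₁ ν, Measure.rnDeriv_lt_top ν₂ ν]
    with x hx ht₁ ht₂ hk₁ hk₂
  have hk₁' : k₁ x = ENNReal.ofReal (k₁ x).toReal := (ENNReal.ofReal_toReal hk₁.ne).symm
  have hk₂' : k₂ x = ENNReal.ofReal (k₂ x).toReal := (ENNReal.ofReal_toReal hk₂.ne).symm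
  set p := (a : ℝ) * (k₁ x).toReal
  set q := (b : ℝ) * (k₂ x).toReal
  have hp : 0 ≤ p := by positivity
  have hq : 0 ≤ q := by positivity
  have hpq : p + q = 1 := by
    have := congrArg ENNReal.toReal hx
    rw [ENNReal.toReal_add (ENNReal.mul_ne_top ENNReal.coe_ne_top hk₁.ne)
      (ENNReal.mul_ne_top ENNReal.coe_ne_top hk₂.ne)] at this
    simpa [p, q] using this
  have hFx : (F x).toReal = p * (f₁ x).toReal + q * (f₂ x).toReal := by
    simp only [hF]
    rw [ENNReal.toReal_add (ENNReal.mul_ne_top ENNReal.coe_ne_top ht₁.ne)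
      (ENNReal.mul_ne_top ENNReal.coe_ne_top ht₂.ne)]
    simp [p, q, mul_assoc]
  have hconv := convexOn_klFun.2 (x := (f₁ x).toReal) (y := (f₂ x).toReal)
    ENNReal.toReal_nonneg ENNReal.toReal_nonneg hp hq hpq
  simp only [smul_eq_mul] at hconv
  rw [hFx]
  refine (ENNReal.ofReal_le_ofReal hconv).trans ?_
  rw [ENNReal.ofReal_add (mul_nonneg hp (klFun_nonneg ENNReal.toReal_nonneg))
    (mul_nonneg hq (klFun_nonneg ENNReal.toReal_nonneg)), ENNReal.ofReal_mul hp,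
    ENNReal.ofReal_mul hq, ENNReal.ofReal_mul (p := (a : ℝ)) a.2,
    ENNReal.ofReal_mul (p := (b : ℝ)) b.2, ← hk₁', ← hk₂',
    ENNReal.ofReal_coe_nnreal, ENNReal.ofReal_coe_nnreal, mul_assoc, mul_assoc]

lemma klDiv_map_of_leftInverse (μ ν : Measure α) [IsFiniteMeasure μ] [IsFiniteMeasure ν]
    {f : α → β} {g : β → α} (hf : Measurable f) (hg : Measurable g) (h : ∀ a, g (f a) = a) :
    klDiv (μ.map f) (ν.map f) = klDiv μ ν := by
  refine le_antisymm (klDiv_map_le _ _ hf) ?_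
  have e : ∀ ρ : Measure α, (ρ.map f).map g = ρ := fun ρ => by
    rw [Measure.map_map hg hf, show g ∘ f = id from funext h, Measure.map_id]
  calc klDiv μ ν = klDiv ((μ.map f).map g) ((ν.map f).map g) := by rw [e, e]
    _ ≤ _ := klDiv_map_le _ _ hg

/-- A bounded density ratio forces a finite divergence. -/
lemma klDiv_ne_top_of_le_smul {μ ν : Measure α} [IsFiniteMeasure μ] [IsFiniteMeasure ν] {c : ℝ≥0}
    (h : μ ≤ c • ν) : klDiv μ ν ≠ ⊤ := by
  have hac : μ ≪ ν := Measure.absolutelyContinuous_of_le_smul (c := (c : ℝ≥0∞)) h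
  have hle : ∀ᵐ a ∂ν, μ.rnDeriv ν a ≤ c := by
    refine ae_le_of_forall_setLIntegral_le_of_sigmaFinite (Measure.measurable_rnDeriv _ _)
      fun s _ _ => ?_
    rw [setLIntegral_const]
    exact (Measure.setLIntegral_rnDeriv_le s).trans (h s)
  rw [klDiv_eq_lintegral_klFun_of_ac hac]
  obtain ⟨M, hM⟩ := isCompact_Icc.exists_bound_of_continuousOn (s := Set.Icc (0 : ℝ) c)
    continuous_klFun.continuousOn
  refine ne_top_of_le_ne_top (b := ∫⁻ _, ENNReal.ofReal M ∂ν) ?_ (lintegral_mono_ae ?_)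
  · rw [lintegral_const]
    exact ENNReal.mul_ne_top ENNReal.ofReal_ne_top (measure_ne_top _ _)
  · filter_upwards [hle] with a ha
    refine ENNReal.ofReal_le_ofReal ((le_abs_self _).trans (hM _ ⟨ENNReal.toReal_nonneg, ?_⟩))
    exact ENNReal.toReal_le_coe_of_le_coe ha

/-- If `P` has first marginal `μ` and finite divergence from `μ ⊗ₘ η`, then a version `g` of its
density with respect to `μ ⊗ₘ η` integrates to at most one along *every* fibre; the usual
version does so only along almost every fibre. -/
lemma exists_density_of_klDiv_ne_top {μ : Measure α} [IsProbabilityMeasure μ] {η : Kernel α β}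
    [IsMarkovKernel η] {P : Measure (α × β)} [IsProbabilityMeasure P] (hP : P.fst = μ)
    (h : klDiv P (μ ⊗ₘ η) ≠ ⊤) :
    ∃ g : α × β → ℝ≥0∞, Measurable g ∧ P = (μ ⊗ₘ η).withDensity g ∧
      (∀ a, ∫⁻ b, g (a, b) ∂(η a) ≤ 1) ∧ (∀ᵐ p ∂P, g p ≠ 0 ∧ g p ≠ ⊤) ∧
      Integrable (fun p => Real.log (g p).toReal) P ∧
      ∫ p, Real.log (g p).toReal ∂P = (klDiv P (μ ⊗ₘ η)).toReal := by
  obtain ⟨hac, hint⟩ := klDiv_ne_top_iff.1 h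
  set f := P.rnDeriv (μ ⊗ₘ η) with hf
  have mf : Measurable f := Measure.measurable_rnDeriv _ _
  have ef : P = (μ ⊗ₘ η).withDensity f := (Measure.withDensity_rnDeriv_eq _ _ hac).symm
  have mI : Measurable fun a => ∫⁻ b, f (a, b) ∂(η a) := mf.lintegral_kernel_prod_right'
  have hfib : ∀ᵐ a ∂μ, ∫⁻ b, f (a, b) ∂(η a) = 1 := by
    have : μ.withDensity (fun a => ∫⁻ b, f (a, b) ∂(η a)) = μ.withDensity 1 := by
      rw [withDensity_one]
      ext s hs
      rw [withDensity_apply _ hs]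
      conv_rhs => rw [← hP, Measure.fst_apply hs, ef, withDensity_apply _ (measurable_fst hs)]
      rw [show Prod.fst ⁻¹' s = s ×ˢ (Set.univ : Set β) by ext; simp,
        Measure.setLIntegral_compProd mf hs MeasurableSet.univ]
      simp
    exact (withDensity_eq_iff_of_sigmaFinite mI.aemeasurable (by fun_prop)).1 this
  set A : Set α := {a | ∫⁻ b, f (a, b) ∂(η a) ≤ 1} with hA
  have mA : MeasurableSet A := measurableSet_le mI measurable_const
  set g : α × β → ℝ≥0∞ := (Prod.fst ⁻¹' A).indicator f with hg
  have mg : Measurable g := mf.indicator (measurable_fst mA)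
  have hgf : g =ᵐ[μ ⊗ₘ η] f := by
    have : ∀ᵐ p ∂(μ ⊗ₘ η), p.1 ∈ A :=
      Measure.ae_compProd_of_ae_fst η mA (hfib.mono fun a ha => ha.le)
    filter_upwards [this] with p hp
    exact Set.indicator_of_mem (s := Prod.fst ⁻¹' A) hp _
  have eg : P = (μ ⊗ₘ η).withDensity g := by rw [withDensity_congr_ae hgf]; exact ef
  have hllr : llr P (μ ⊗ₘ η) =ᵐ[P] fun p => Real.log (g p).toReal := by
    filter_upwards [hac.ae_le hgf] with p hp
    rw [llr, hp]
  refine ⟨g, mg, eg, fun a => ?_, ?_, hint.congr hllr, ?_⟩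
  · by_cases ha : a ∈ A
    · refine le_trans (lintegral_mono fun b => ?_) (show ∫⁻ b, f (a, b) ∂(η a) ≤ 1 from ha)
      exact Set.indicator_le_self _ _ _
    · have : ∀ b, g (a, b) = 0 := fun b =>
        Set.indicator_of_notMem (s := Prod.fst ⁻¹' A) ha _
      simp [this]
  · filter_upwards [hac.ae_le hgf, Measure.rnDeriv_pos hac,
      hac.ae_le (Measure.rnDeriv_lt_top P (μ ⊗ₘ η))] with p h1 h2 h3
    rw [h1]
    exact ⟨h2.ne', h3.ne⟩
  · rw [← integral_congr_ae hllr, toReal_klDiv_of_measure_eq hac (by simp)]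

end Divergence

/-! ### Single-letter quantities as functionals of the joint law -/

section SingleLetter

open InformationTheory

variable {𝒳 𝒮 𝒯 𝒵 : Type*} [MeasurableSpace 𝒳] [MeasurableSpace 𝒮] [MeasurableSpace 𝒯]
  [MeasurableSpace 𝒵]
variable (PX : Measure 𝒳) [IsProbabilityMeasure PX] (PS : Measure 𝒮) [IsProbabilityMeasure PS]
  (W : Kernel (𝒳 × 𝒮) 𝒯)

lemma lintegral_echoKernel (x : 𝒳) {F : 𝒯 → ℝ≥0∞} (hF : Measurable F) :
    ∫⁻ t, F t ∂(echoKernel PS W x) = ∫⁻ s, ∫⁻ t, F t ∂(W (x, s)) ∂PS := by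
  rw [echoKernel, Kernel.lintegral_comp _ _ _ hF, Kernel.prod_apply, Kernel.id_apply,
    Kernel.const_apply, lintegral_prod _ (hF.lintegral_kernel).aemeasurable, lintegral_dirac']
  exact Measurable.lintegral_prod_right' (f := fun p : 𝒳 × 𝒮 => ∫⁻ t, F t ∂(W p))
    hF.lintegral_kernel

variable [IsMarkovKernel W]

instance : IsMarkovKernel (echoKernel PS W) := by unfold echoKernel; infer_instance

instance (Q : Kernel (𝒳 × 𝒯) 𝒵) [IsMarkovKernel Q] : IsMarkovKernel (reconKernel PS W Q) := by
  unfold reconKernel; infer_instance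

instance : IsProbabilityMeasure (letterLaw PX PS W) :=
  Measure.isProbabilityMeasure_map (by fun_prop)

/-- The law of one pair `(X, T)`. -/
def echoLaw : Measure (𝒳 × 𝒯) := PX ⊗ₘ echoKernel PS W

instance : IsProbabilityMeasure (echoLaw PX PS W) := by unfold echoLaw; infer_instance

/-- The law of one triple `((X, T), S)`. -/
def observedLaw : Measure ((𝒳 × 𝒯) × 𝒮) :=
  (letterLaw PX PS W).map fun p => ((p.1, p.2.2), p.2.1)

instance : IsProbabilityMeasure (observedLaw PX PS W) :=
  Measure.isProbabilityMeasure_map (by fun_prop)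

lemma lintegral_reconKernel (Q : Kernel (𝒳 × 𝒯) 𝒵) [IsMarkovKernel Q] (x : 𝒳) {F : 𝒵 → ℝ≥0∞}
    (hF : Measurable F) :
    ∫⁻ z, F z ∂(reconKernel PS W Q x) = ∫⁻ t, ∫⁻ z, F z ∂(Q (x, t)) ∂(echoKernel PS W x) := by
  rw [reconKernel, Kernel.lintegral_comp _ _ _ hF, Kernel.prod_apply, Kernel.id_apply,
    lintegral_prod _ (hF.lintegral_kernel).aemeasurable, lintegral_dirac']
  exact Measurable.lintegral_prod_right' (f := fun p : 𝒳 × 𝒯 => ∫⁻ z, F z ∂(Q p))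
    hF.lintegral_kernel

lemma observedLaw_fst : (observedLaw PX PS W).fst = echoLaw PX PS W := by
  refine Measure.ext_of_lintegral _ fun F hF => ?_
  rw [Measure.fst, lintegral_map hF measurable_fst, observedLaw,
    lintegral_map (by fun_prop) (by fun_prop), letterLaw,
    lintegral_map (by fun_prop) (by fun_prop), Measure.lintegral_compProd (by fun_prop), echoLaw,
    Measure.lintegral_compProd hF, lintegral_prod]
  · refine lintegral_congr fun x => ?_
    rw [lintegral_echoKernel PS W x (by fun_prop)]
  · exact (Measurable.lintegral_kernel_prod_right'
      (f := fun p : (𝒳 × 𝒮) × 𝒯 => F (p.1.1, p.2)) (by fun_prop)).aemeasurable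

section State

variable [StandardBorelSpace 𝒮] [Nonempty 𝒮]

/-- The conditional law of the state given the codeword letter and the echo, `P_{S|XT}`. -/
def stateKernel : Kernel (𝒳 × 𝒯) 𝒮 := (observedLaw PX PS W).condKernel

instance : IsMarkovKernel (stateKernel PX PS W) := by unfold stateKernel; infer_instance

lemma echoLaw_compProd_stateKernel :
    echoLaw PX PS W ⊗ₘ stateKernel PX PS W = observedLaw PX PS W := by
  rw [← observedLaw_fst]
  exact (observedLaw PX PS W).disintegrate (observedLaw PX PS W).condKernel

/-- The distortion seen by the estimator, which does not observe the state:
`((x, t), z) ↦ E[d(S, z) | X = x, T = t]`. -/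
def echoDistortion (d : 𝒮 → 𝒵 → ℝ≥0∞) (p : (𝒳 × 𝒯) × 𝒵) : ℝ≥0∞ :=
  ∫⁻ s, d s p.2 ∂(stateKernel PX PS W p.1)

variable {d : 𝒮 → 𝒵 → ℝ≥0∞}

lemma measurable_echoDistortion (hd : Measurable (Function.uncurry d)) :
    Measurable (echoDistortion PX PS W d) := by
  have : Measurable fun q : ((𝒳 × 𝒯) × 𝒵) × 𝒮 => d q.2 q.1.2 :=
    hd.comp (by fun_prop : Measurable fun q : ((𝒳 × 𝒯) × 𝒵) × 𝒮 => (q.2, q.1.2))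
  exact Measurable.lintegral_kernel_prod_right' (κ := (stateKernel PX PS W).prodMkRight 𝒵) this

lemma letterDistortion_eq (hd : Measurable (Function.uncurry d)) (Q : Kernel (𝒳 × 𝒯) 𝒵)
    [IsMarkovKernel Q] :
    letterDistortion PX PS W d Q = ∫⁻ p, echoDistortion PX PS W d p ∂(echoLaw PX PS W ⊗ₘ Q) := by
  have m1 : Measurable fun q : ((𝒳 × 𝒯) × 𝒮) × 𝒵 => d q.1.2 q.2 :=
    hd.comp (by fun_prop : Measurable fun q : ((𝒳 × 𝒯) × 𝒮) × 𝒵 => (q.1.2, q.2))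
  have m2 : Measurable fun q : (𝒳 × 𝒯) × 𝒮 => ∫⁻ z, d q.2 z ∂(Q q.1) :=
    Measurable.lintegral_kernel_prod_right' (κ := Q.prodMkRight 𝒮) m1
  have e1 : letterDistortion PX PS W d Q =
      ∫⁻ q : (𝒳 × 𝒯) × 𝒮, ∫⁻ z, d q.2 z ∂(Q q.1) ∂(observedLaw PX PS W) := by
    rw [observedLaw, lintegral_map m2 (by fun_prop)]
    rfl
  rw [e1, ← echoLaw_compProd_stateKernel, Measure.lintegral_compProd m2,
    Measure.lintegral_compProd (measurable_echoDistortion PX PS W hd)]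
  refine lintegral_congr fun a => ?_
  exact lintegral_lintegral_swap (μ := stateKernel PX PS W a) (ν := Q a)
    (f := fun s z => d s z) hd.aemeasurable

lemma lintegral_echoDistortion_const (hd : Measurable (Function.uncurry d)) (z : 𝒵) :
    ∫⁻ a, echoDistortion PX PS W d (a, z) ∂(echoLaw PX PS W) = ∫⁻ s, d s z ∂PS := by
  have hdz : Measurable fun s => d s z := hd.comp (by fun_prop : Measurable fun s => (s, z))
  have : ∫⁻ a, echoDistortion PX PS W d (a, z) ∂(echoLaw PX PS W) =
      ∫⁻ q, d q.2 z ∂(observedLaw PX PS W) := by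
    rw [← echoLaw_compProd_stateKernel, Measure.lintegral_compProd (f := fun q => d q.2 z)
      (hdz.comp measurable_snd)]
    rfl
  rw [this, observedLaw, lintegral_map (by fun_prop) (by fun_prop), letterLaw,
    lintegral_map (by fun_prop) (by fun_prop), Measure.lintegral_compProd (by fun_prop)]
  simp only [lintegral_const, measure_univ, mul_one]
  rw [lintegral_prod _ (by fun_prop)]
  simp

end State

/-- The reordering `((x, t), z) ↦ ((x, z), t)`. -/
def swapEcho (p : (𝒳 × 𝒯) × 𝒵) : (𝒳 × 𝒵) × 𝒯 := ((p.1.1, p.2), p.1.2)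

lemma measurable_swapEcho : Measurable (swapEcho : (𝒳 × 𝒯) × 𝒵 → (𝒳 × 𝒵) × 𝒯) := by
  unfold swapEcho; fun_prop

/-- `I(T; Z | X) = D(P_{T|XZ} ‖ P_{T|X} | P_{XZ})` as a functional of the law `P` of
`((X, T), Z)`. -/
def echoInfo (P : Measure ((𝒳 × 𝒯) × 𝒵)) : ℝ≥0∞ :=
  klDiv (P.map swapEcho) ((P.map swapEcho).fst ⊗ₘ (echoKernel PS W).prodMkRight 𝒵)

lemma lintegral_echoLaw_compProd (Q : Kernel (𝒳 × 𝒯) 𝒵) [IsMarkovKernel Q]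
    {F : (𝒳 × 𝒯) × 𝒵 → ℝ≥0∞} (hF : Measurable F) :
    ∫⁻ p, F p ∂(echoLaw PX PS W ⊗ₘ Q) =
      ∫⁻ x, ∫⁻ t, ∫⁻ z, F ((x, t), z) ∂(Q (x, t)) ∂(echoKernel PS W x) ∂PX := by
  rw [Measure.lintegral_compProd hF, echoLaw, Measure.lintegral_compProd]
  exact Measurable.lintegral_kernel_prod_right' (κ := Q) hF

/-- Exchanging the roles of `T` and `Z`: given `X`, the pair has law `P_{T|X} × P_{Z|X}`. -/
lemma map_swapEcho_prod (Q : Kernel (𝒳 × 𝒯) 𝒵) [IsMarkovKernel Q] :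
    (echoLaw PX PS W ⊗ₘ Kernel.prodMkRight 𝒯 (reconKernel PS W Q)).map swapEcho =
      ((echoLaw PX PS W ⊗ₘ Q).map swapEcho).fst ⊗ₘ (echoKernel PS W).prodMkRight 𝒵 := by
  refine Measure.ext_of_lintegral _ fun F hF => ?_
  have mF : Measurable fun p : (𝒳 × 𝒯) × 𝒵 => F (swapEcho p) := hF.comp measurable_swapEcho
  set G : 𝒳 × 𝒵 → ℝ≥0∞ := fun p => ∫⁻ t, F (p, t) ∂(echoKernel PS W p.1) with hG
  have mG : Measurable G :=
    Measurable.lintegral_kernel_prod_right' (κ := (echoKernel PS W).prodMkRight 𝒵) hF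
  have mG1 : Measurable fun q : (𝒳 × 𝒵) × 𝒯 => G q.1 := mG.comp measurable_fst
  have mG2 : Measurable fun p : (𝒳 × 𝒯) × 𝒵 => G (swapEcho p).1 := mG1.comp measurable_swapEcho
  rw [lintegral_map hF measurable_swapEcho, lintegral_echoLaw_compProd PX PS W _ mF,
    Measure.lintegral_compProd hF]
  change _ = ∫⁻ p, G p ∂_
  rw [Measure.fst, lintegral_map mG measurable_fst, lintegral_map mG1 measurable_swapEcho,
    lintegral_echoLaw_compProd PX PS W Q mG2]
  refine lintegral_congr fun x => ?_
  have mGx : Measurable fun z => G (x, z) := mG.comp (by fun_prop)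
  have mFx : Measurable fun q : 𝒯 × 𝒵 => F ((x, q.2), q.1) := hF.comp (by fun_prop)
  change _ = ∫⁻ t, ∫⁻ z, G (x, z) ∂(Q (x, t)) ∂(echoKernel PS W x)
  rw [← lintegral_reconKernel PS W Q x mGx]
  exact lintegral_lintegral_swap (μ := echoKernel PS W x) (ν := reconKernel PS W Q x)
    (f := fun t z => F ((x, z), t)) mFx.aemeasurable

lemma condMutualInfo_eq (Q : Kernel (𝒳 × 𝒯) 𝒵) [IsMarkovKernel Q] :
    condMutualInfo PX PS W Q = echoInfo PS W (echoLaw PX PS W ⊗ₘ Q) := by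
  rw [condMutualInfo, echoInfo, ← map_swapEcho_prod, ← echoLaw]
  exact (klDiv_map_of_leftInverse (echoLaw PX PS W ⊗ₘ Q) _ measurable_swapEcho
    measurable_swapEcho fun _ => rfl).symm

lemma infoRate_le [StandardBorelSpace 𝒮] [Nonempty 𝒮] [StandardBorelSpace 𝒵] [Nonempty 𝒵]
    {d : 𝒮 → 𝒵 → ℝ≥0∞} (hd : Measurable (Function.uncurry d)) {D : ℝ≥0∞}
    {P : Measure ((𝒳 × 𝒯) × 𝒵)} [IsFiniteMeasure P] (hP : P.fst = echoLaw PX PS W)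
    (hD : ∫⁻ p, echoDistortion PX PS W d p ∂P ≤ D) :
    infoRate PX PS W d D ≤ echoInfo PS W P := by
  have e : echoLaw PX PS W ⊗ₘ P.condKernel = P := by rw [← hP]; exact P.disintegrate _
  have h1 : letterDistortion PX PS W d P.condKernel ≤ D := by
    rw [letterDistortion_eq PX PS W hd, e]; exact hD
  refine (iInf_le_of_le P.condKernel (iInf_le_of_le inferInstance (iInf_le_of_le h1 ?_)))
  rw [condMutualInfo_eq, e]

/-- Among all references `ρ ⊗ P_{T|X}` the one with `ρ = P_{XZ}` is closest to `P`. -/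
lemma echoInfo_le [StandardBorelSpace 𝒯] [Nonempty 𝒯] (P : Measure ((𝒳 × 𝒯) × 𝒵))
    [IsFiniteMeasure P] (ρ : Measure (𝒳 × 𝒵)) [IsFiniteMeasure ρ] :
    echoInfo PS W P ≤ klDiv (P.map swapEcho) (ρ ⊗ₘ (echoKernel PS W).prodMkRight 𝒵) := by
  set P' := P.map (swapEcho : (𝒳 × 𝒯) × 𝒵 → (𝒳 × 𝒵) × 𝒯)
  have e : P'.fst ⊗ₘ P'.condKernel = P' := P'.disintegrate _
  have h := klDiv_compProd_eq_add P'.fst ρ P'.condKernel ((echoKernel PS W).prodMkRight 𝒵)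
  rw [e] at h
  rw [h]
  exact le_add_self

lemma echoInfo_convex (P₁ P₂ : Measure ((𝒳 × 𝒯) × 𝒵)) [IsFiniteMeasure P₁] [IsFiniteMeasure P₂]
    {a b : ℝ≥0} (ha : a ≠ 0) (hb : b ≠ 0) :
    echoInfo PS W (a • P₁ + b • P₂) ≤ a * echoInfo PS W P₁ + b * echoInfo PS W P₂ := by
  have e : (a • P₁ + b • P₂).map (swapEcho : (𝒳 × 𝒯) × 𝒵 → (𝒳 × 𝒵) × 𝒯) =
      a • P₁.map swapEcho + b • P₂.map swapEcho := by
    rw [Measure.map_add _ _ measurable_swapEcho, Measure.map_smul, Measure.map_smul]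
  have e2 : (a • P₁.map swapEcho + b • P₂.map swapEcho).fst =
      a • (P₁.map (swapEcho : (𝒳 × 𝒯) × 𝒵 → (𝒳 × 𝒵) × 𝒯)).fst + b • (P₂.map swapEcho).fst := by
    rw [Measure.fst, Measure.map_add _ _ measurable_fst, Measure.map_smul, Measure.map_smul]
    rfl
  have e3 : ∀ (c : ℝ≥0) (ρ : Measure (𝒳 × 𝒵)) [IsFiniteMeasure ρ],
      (c • ρ) ⊗ₘ (echoKernel PS W).prodMkRight 𝒵 = c • (ρ ⊗ₘ (echoKernel PS W).prodMkRight 𝒵) :=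
    fun c ρ _ => Measure.compProd_smul_left (c : ℝ≥0∞)
  rw [echoInfo, e, e2, Measure.compProd_add_left, e3, e3]
  exact klDiv_convex _ _ _ _ ha hb

end SingleLetter

/-! ### The joint law induced by an estimator -/

section EstimatorLaw

open InformationTheory

variable {𝒳 𝒮 𝒯 𝒵 : Type*} [MeasurableSpace 𝒳] [MeasurableSpace 𝒮] [MeasurableSpace 𝒯]
  [MeasurableSpace 𝒵] {n K : ℕ}

namespace Estimator

attribute [instance] markov_enc markov_dec

variable (h : Estimator 𝒳 𝒯 𝒵 n K)

/-- The channel from `(xⁿ, tⁿ)` to `zⁿ` obtained by composing the two maps of an estimator. -/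
def channel : Kernel (Fin n → 𝒳 × 𝒯) (Fin n → 𝒵) :=
  h.dec ∘ₖ (Kernel.deterministic (fun a i => (a i).1) (by fun_prop) ×ₖ
    h.enc.comap (fun a => (fun i => (a i).1, fun i => (a i).2)) (by fun_prop))

instance : IsMarkovKernel h.channel := by unfold channel; infer_instance

lemma lintegral_channel (a : Fin n → 𝒳 × 𝒯) {F : (Fin n → 𝒵) → ℝ≥0∞} (hF : Measurable F) :
    ∫⁻ z, F z ∂(h.channel a) =
      ∫⁻ w, ∫⁻ z, F z ∂(h.dec (fun i => (a i).1, w))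
        ∂(h.enc (fun i => (a i).1, fun i => (a i).2)) := by
  rw [channel, Kernel.lintegral_comp _ _ _ hF, Kernel.prod_apply, Kernel.deterministic_apply,
    lintegral_prod _ (hF.lintegral_kernel).aemeasurable, lintegral_dirac']
  · rw [Kernel.comap_apply]
  · exact Measurable.lintegral_prod_right'
      (f := fun p : (Fin n → 𝒳) × Fin K => ∫⁻ z, F z ∂(h.dec p)) hF.lintegral_kernel

/-- The unnormalised channel from `xⁿ` to `zⁿ` in which every index is used with weight one. It
dominates `Estimator.channel` and does not see the echo. -/
def dominating : Kernel (Fin n → 𝒳) (Fin n → 𝒵) :=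
  h.dec ∘ₖ (Kernel.id ×ₖ Kernel.const _ (Measure.count : Measure (Fin K)))

instance : IsFiniteKernel h.dominating := by unfold dominating; infer_instance

lemma lintegral_dominating (x : Fin n → 𝒳) {F : (Fin n → 𝒵) → ℝ≥0∞} (hF : Measurable F) :
    ∫⁻ z, F z ∂(h.dominating x) = ∫⁻ w, ∫⁻ z, F z ∂(h.dec (x, w)) ∂Measure.count := by
  rw [dominating, Kernel.lintegral_comp _ _ _ hF, Kernel.prod_apply, Kernel.id_apply,
    Kernel.const_apply, lintegral_prod _ (hF.lintegral_kernel).aemeasurable, lintegral_dirac']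
  exact Measurable.lintegral_prod_right'
    (f := fun p : (Fin n → 𝒳) × Fin K => ∫⁻ z, F z ∂(h.dec p)) hF.lintegral_kernel

lemma lintegral_channel_le (a : Fin n → 𝒳 × 𝒯) {F : (Fin n → 𝒵) → ℝ≥0∞} (hF : Measurable F) :
    ∫⁻ z, F z ∂(h.channel a) ≤ ∫⁻ z, F z ∂(h.dominating fun i => (a i).1) := by
  rw [lintegral_channel h a hF, lintegral_dominating h _ hF, lintegral_fintype, lintegral_fintype]
  refine Finset.sum_le_sum fun w _ => ?_
  rw [Measure.count_singleton]
  gcongr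
  exact prob_le_one

variable (PX : Measure 𝒳) (PS : Measure 𝒮) (W : Kernel (𝒳 × 𝒮) 𝒯)

/-- The joint law of `(Xⁿ, Tⁿ)` and the reconstruction `Zⁿ`. -/
def jointLaw : Measure ((Fin n → 𝒳 × 𝒯) × (Fin n → 𝒵)) :=
  (Measure.pi fun _ => echoLaw PX PS W) ⊗ₘ h.channel

/-- The law of `((X_J, T_J), Z_J)` for a uniformly random position `J`. -/
def averageLaw : Measure ((𝒳 × 𝒯) × 𝒵) :=
  (n : ℝ≥0)⁻¹ • ∑ i, (h.jointLaw PX PS W).map fun q => (q.1 i, q.2 i)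

lemma lintegral_averageLaw {F : (𝒳 × 𝒯) × 𝒵 → ℝ≥0∞} (hF : Measurable F) :
    ∫⁻ p, F p ∂(h.averageLaw PX PS W) =
      (n : ℝ≥0∞)⁻¹ * ∑ i, ∫⁻ q, F (q.1 i, q.2 i) ∂(h.jointLaw PX PS W) := by
  rw [averageLaw, lintegral_smul_measure, lintegral_finsetSum_measure]
  rcases eq_or_ne n 0 with rfl | hn
  · simp
  · rw [ENNReal.smul_def, smul_eq_mul, ENNReal.coe_inv (by exact_mod_cast hn)]
    congr 1
    refine Finset.sum_congr rfl fun i _ => ?_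
    rw [lintegral_map hF (by fun_prop)]

lemma averageLaw_map_swapEcho : (h.averageLaw PX PS W).map swapEcho =
    (n : ℝ≥0)⁻¹ • ∑ i, (h.jointLaw PX PS W).map fun q => swapEcho (q.1 i, q.2 i) := by
  rw [averageLaw, Measure.map_smul, ← Measure.mapₗ_apply_of_measurable measurable_swapEcho, map_sum]
  congr 1
  refine Finset.sum_congr rfl fun i _ => ?_
  rw [Measure.mapₗ_apply_of_measurable measurable_swapEcho,
    Measure.map_map measurable_swapEcho (by fun_prop)]
  rfl

variable [IsProbabilityMeasure PX] [IsProbabilityMeasure PS] [IsMarkovKernel W]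

lemma distortion_eq [StandardBorelSpace 𝒮] [Nonempty 𝒮] {d : 𝒮 → 𝒵 → ℝ≥0∞}
    (hd : Measurable (Function.uncurry d)) :
    h.distortion PX PS W d =
      ∫⁻ a, ∫⁻ z, (∑ i, echoDistortion PX PS W d (a i, z i)) / n ∂(h.channel a)
        ∂(Measure.pi fun _ : Fin n => echoLaw PX PS W) := by
  have mδ := measurable_echoDistortion PX PS W hd
  obtain ⟨f, hf, hfκ⟩ := (stateKernel PX PS W).exists_measurable_map_eq_unitInterval
  set G : (Fin n → (𝒳 × 𝒯) × 𝒮) → ℝ≥0∞ := fun q =>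
    ∫⁻ z, (∑ i, d (q i).2 (z i)) / n ∂(h.channel fun i => (q i).1) with hG
  have mG : Measurable G := by
    refine Measurable.lintegral_kernel_prod_right'
      (κ := h.channel.comap (fun q : Fin n → (𝒳 × 𝒯) × 𝒮 => fun i => (q i).1) (by fun_prop))
      (f := fun p : (Fin n → (𝒳 × 𝒯) × 𝒮) × (Fin n → 𝒵) => (∑ i, d (p.1 i).2 (p.2 i)) / n) ?_
    fun_prop
  have mr : Measurable fun p : 𝒳 × 𝒮 × 𝒯 => ((p.1, p.2.2), p.2.1) := by fun_prop
  have e1 : (blockLaw PX PS W n).map (fun p i => (((p i).1, (p i).2.2), (p i).2.1)) =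
      Measure.pi fun _ : Fin n => observedLaw PX PS W :=
    Measure.pi_map_pi (μ := fun _ : Fin n => letterLaw PX PS W)
      (f := fun _ (p : 𝒳 × 𝒮 × 𝒯) => ((p.1, p.2.2), p.2.1)) (fun _ => mr.aemeasurable)
  have e2 : h.distortion PX PS W d = ∫⁻ q, G q ∂(Measure.pi fun _ : Fin n => observedLaw PX PS W) := by
    rw [← e1, lintegral_map mG (by fun_prop)]
    refine lintegral_congr fun p => ?_
    rw [hG]
    exact (lintegral_channel h (fun i => ((p i).1, (p i).2.2))
      (F := fun z => (∑ i, d (p i).2.1 (z i)) / n)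
      (by fun_prop)).symm
  rw [e2, ← echoLaw_compProd_stateKernel, lintegral_pi_compProd _ _ hf hfκ mG]
  refine lintegral_congr fun a => ?_
  have mfa : ∀ i, Measurable (f (a i)) := fun i => by fun_prop
  have mfd : ∀ i, Measurable fun p : (Fin n → unitInterval) × (Fin n → 𝒵) =>
      d (f (a i) (p.1 i)) (p.2 i) := fun i => by fun_prop
  simp only [hG]
  rw [lintegral_lintegral_swap (((Finset.measurable_sum _ fun i _ => mfd i).div_const _).aemeasurable)]
  refine lintegral_congr fun z => ?_
  have mfz : ∀ i, Measurable fun u : Fin n → unitInterval => d (f (a i) (u i)) (z i) := fun i =>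
    (mfd i).comp (by fun_prop : Measurable fun u : Fin n → unitInterval => (u, z))
  simp only [div_eq_mul_inv]
  rw [lintegral_mul_const _ (Finset.measurable_sum _ fun i _ => mfz i),
    lintegral_finsetSum _ fun i _ => mfz i]
  congr 1
  refine Finset.sum_congr rfl fun i _ => ?_
  rw [lintegral_pi_eval (fun _ => volume) i (f := fun v => d (f (a i) v) (z i))
    (by fun_prop), echoDistortion, ← hfκ (a i),
    lintegral_map (by fun_prop) (mfa i)]

instance : IsProbabilityMeasure (h.jointLaw PX PS W) := by unfold jointLaw; infer_instance

instance : IsFiniteMeasure (h.averageLaw PX PS W) := by unfold averageLaw; infer_instance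

lemma averageLaw_fst (hn : n ≠ 0) : (h.averageLaw PX PS W).fst = echoLaw PX PS W := by
  refine Measure.ext_of_lintegral _ fun F hF => ?_
  rw [Measure.fst, lintegral_map hF measurable_fst,
    lintegral_averageLaw h PX PS W (by fun_prop)]
  have : ∀ i : Fin n, ∫⁻ q, F (q.1 i) ∂(h.jointLaw PX PS W) = ∫⁻ a, F a ∂(echoLaw PX PS W) := by
    intro i
    rw [jointLaw, Measure.lintegral_compProd (by fun_prop)]
    simp only [lintegral_const, measure_univ, mul_one]
    exact lintegral_pi_eval _ i hF
  simp only [this, Finset.sum_const, Finset.card_univ, Fintype.card_fin, nsmul_eq_mul]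
  rw [← mul_assoc, ENNReal.inv_mul_cancel (by exact_mod_cast hn) (ENNReal.natCast_ne_top n), one_mul]

lemma isProbabilityMeasure_averageLaw (hn : n ≠ 0) :
    IsProbabilityMeasure (h.averageLaw PX PS W) := by
  constructor
  rw [← Measure.fst_univ, averageLaw_fst h PX PS W hn, measure_univ]

lemma lintegral_averageLaw_echoDistortion [StandardBorelSpace 𝒮] [Nonempty 𝒮] {d : 𝒮 → 𝒵 → ℝ≥0∞}
    (hd : Measurable (Function.uncurry d)) :
    ∫⁻ p, echoDistortion PX PS W d p ∂(h.averageLaw PX PS W) = h.distortion PX PS W d := by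
  have mδ := measurable_echoDistortion PX PS W hd
  have mδi : ∀ i : Fin n, Measurable fun q : (Fin n → 𝒳 × 𝒯) × (Fin n → 𝒵) =>
    echoDistortion PX PS W d (q.1 i, q.2 i) := fun i => mδ.comp (by fun_prop)
  rw [lintegral_averageLaw h PX PS W mδ, distortion_eq h PX PS W hd,
    ← lintegral_finsetSum _ fun i _ => mδi i,
    ← lintegral_const_mul _ (Finset.measurable_sum _ fun i _ => mδi i), jointLaw,
    Measure.lintegral_compProd ((Finset.measurable_sum _ fun i _ => mδi i).const_mul _)]
  simp only [div_eq_mul_inv, mul_comm]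

/-! ### Converse -/

/-- The law of `(Xⁿ, Zⁿ)` under `Estimator.dominating`, of total mass `K`. -/
def dominatingLaw : Measure ((Fin n → 𝒳) × (Fin n → 𝒵)) :=
  (Measure.pi fun _ => PX) ⊗ₘ h.dominating

instance : IsFiniteMeasure (h.dominatingLaw PX) := by unfold dominatingLaw; infer_instance

lemma dominatingLaw_univ : h.dominatingLaw PX Set.univ = K := by
  rw [dominatingLaw, ← lintegral_one, Measure.lintegral_compProd measurable_const]
  simp_rw [lintegral_dominating h _ measurable_const]
  simp

/-- Up to the total mass `K`, the joint law of an estimator is dominated by a law under which the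
echo letters are independent outputs of `P_{T|X}` given `(Xⁿ, Zⁿ)`; here `f` realises `P_{T|X}`
from uniform noise. -/
lemma lintegral_jointLaw_le {f : 𝒳 → unitInterval → 𝒯} (hf : Measurable (Function.uncurry f))
    (hfE : ∀ x, volume.map (f x) = echoKernel PS W x)
    {F : (Fin n → (𝒳 × 𝒵) × 𝒯) → ℝ≥0∞} (hF : Measurable F) :
    ∫⁻ q, F (fun i => swapEcho (q.1 i, q.2 i)) ∂(h.jointLaw PX PS W) ≤
      ∫⁻ p, ∫⁻ u, F (fun i => ((p.1 i, p.2 i), f (p.1 i) (u i)))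
        ∂(Measure.pi fun _ : Fin n => volume) ∂(h.dominatingLaw PX) := by
  have mF : Measurable fun q : (Fin n → 𝒳 × 𝒯) × (Fin n → 𝒵) =>
      F (fun i => swapEcho (q.1 i, q.2 i)) :=
    hF.comp (measurable_pi_lambda _ fun i => measurable_swapEcho.comp (by fun_prop))
  have mf : Measurable fun p : ((Fin n → 𝒳) × (Fin n → 𝒵)) × (Fin n → unitInterval) =>
      F (fun i => ((p.1.1 i, p.1.2 i), f (p.1.1 i) (p.2 i))) := by
    refine hF.comp (measurable_pi_lambda _ fun i => ?_)
    exact (by fun_prop : Measurable fun p : ((Fin n → 𝒳) × (Fin n → 𝒵)) × (Fin n → unitInterval) =>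
      (p.1.1 i, p.1.2 i)).prodMk (hf.comp (by fun_prop :
        Measurable fun p : ((Fin n → 𝒳) × (Fin n → 𝒵)) × (Fin n → unitInterval) =>
          (p.1.1 i, p.2 i)))
  have mΦ : Measurable fun a : Fin n → 𝒳 × 𝒯 =>
      ∫⁻ z, F (fun i => swapEcho (a i, z i)) ∂(h.dominating fun i => (a i).1) :=
    Measurable.lintegral_kernel_prod_right'
      (κ := h.dominating.comap (fun a : Fin n → 𝒳 × 𝒯 => fun i => (a i).1) (by fun_prop)) mF
  calc ∫⁻ q, F (fun i => swapEcho (q.1 i, q.2 i)) ∂(h.jointLaw PX PS W)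
      = ∫⁻ a, ∫⁻ z, F (fun i => swapEcho (a i, z i)) ∂(h.channel a)
          ∂(Measure.pi fun _ => echoLaw PX PS W) := by
        rw [jointLaw, Measure.lintegral_compProd mF]
    _ ≤ ∫⁻ a, ∫⁻ z, F (fun i => swapEcho (a i, z i)) ∂(h.dominating fun i => (a i).1)
          ∂(Measure.pi fun _ => echoLaw PX PS W) :=
        lintegral_mono fun a => lintegral_channel_le h a (mF.comp (by fun_prop :
          Measurable fun z : Fin n → 𝒵 => (a, z)))
    _ = ∫⁻ x, ∫⁻ u, ∫⁻ z, F (fun i => ((x i, z i), f (x i) (u i))) ∂(h.dominating x)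
          ∂(Measure.pi fun _ : Fin n => volume) ∂(Measure.pi fun _ => PX) := by
        rw [echoLaw, lintegral_pi_compProd PX _ hf hfE mΦ]
        rfl
    _ = ∫⁻ x, ∫⁻ z, ∫⁻ u, F (fun i => ((x i, z i), f (x i) (u i)))
          ∂(Measure.pi fun _ : Fin n => volume) ∂(h.dominating x) ∂(Measure.pi fun _ => PX) := by
        refine lintegral_congr fun x => ?_
        refine lintegral_lintegral_swap ?_
        exact (mf.comp (by fun_prop : Measurable fun q : (Fin n → unitInterval) × (Fin n → 𝒵) =>
          ((x, q.2), q.1))).aemeasurable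
    _ = _ := by
        rw [dominatingLaw, Measure.lintegral_compProd mf.lintegral_prod_right']

end Estimator

end EstimatorLaw

section Converse

open InformationTheory

variable {𝒳 𝒮 𝒯 𝒵 : Type*} [MeasurableSpace 𝒳] [MeasurableSpace 𝒮] [MeasurableSpace 𝒯]
  [MeasurableSpace 𝒵] {n K : ℕ}

namespace Estimator

variable (h : Estimator 𝒳 𝒯 𝒵 n K)
variable (PX : Measure 𝒳) [IsProbabilityMeasure PX] (PS : Measure 𝒮) [IsProbabilityMeasure PS]
  (W : Kernel (𝒳 × 𝒮) 𝒯) [IsMarkovKernel W] [StandardBorelSpace 𝒯] [Nonempty 𝒯]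

lemma echoInfo_averageLaw_ne_top (hn : n ≠ 0) : echoInfo PS W (h.averageLaw PX PS W) ≠ ⊤ := by
  obtain ⟨f, hf, hfE⟩ := (echoKernel PS W).exists_measurable_map_eq_unitInterval
  set E := (echoKernel PS W).prodMkRight 𝒵
  set ρ : Fin n → Measure (𝒳 × 𝒵) := fun i => (h.dominatingLaw PX).map fun p => (p.1 i, p.2 i)
  have hρ : ∀ i, (h.jointLaw PX PS W).map (fun q => swapEcho (q.1 i, q.2 i)) ≤ ρ i ⊗ₘ E := by
    intro i
    refine Measure.le_iff.2 fun s hs => ?_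
    have mind : Measurable (s.indicator (1 : (𝒳 × 𝒵) × 𝒯 → ℝ≥0∞)) := measurable_one.indicator hs
    have mproj : Measurable fun q : (Fin n → 𝒳 × 𝒯) × (Fin n → 𝒵) => swapEcho (q.1 i, q.2 i) :=
      measurable_swapEcho.comp (by fun_prop)
    rw [← lintegral_indicator_one hs, ← lintegral_indicator_one hs, lintegral_map mind mproj,
      Measure.lintegral_compProd mind, lintegral_map (Measurable.lintegral_kernel_prod_right' mind)
        (by fun_prop)]
    refine (lintegral_jointLaw_le h PX PS W hf hfE
      (F := fun v => s.indicator 1 (v i)) (mind.comp (measurable_pi_apply i))).trans_eq ?_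
    refine lintegral_congr fun p => ?_
    have mfx : Measurable (f (p.1 i)) := by fun_prop
    have mind' : Measurable fun t => s.indicator (1 : (𝒳 × 𝒵) × 𝒯 → ℝ≥0∞) ((p.1 i, p.2 i), t) :=
      mind.comp (by fun_prop)
    rw [lintegral_pi_eval (fun _ => volume) i
      (f := fun v => s.indicator (1 : (𝒳 × 𝒵) × 𝒯 → ℝ≥0∞) ((p.1 i, p.2 i), f (p.1 i) v))
      (mind'.comp mfx), Kernel.prodMkRight_apply, ← hfE, lintegral_map mind' mfx]
  have hle : (h.averageLaw PX PS W).map swapEcho ≤ (1 : ℝ≥0) • ((∑ i, ρ i) ⊗ₘ E) := by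
    rw [averageLaw_map_swapEcho, one_smul]
    have e : (∑ i, ρ i) ⊗ₘ E = ∑ i, ρ i ⊗ₘ E := by
      rw [← Measure.sum_fintype, ← Measure.sum_fintype, Measure.compProd_sum_left]
    rw [e]
    refine Measure.le_iff.2 fun s hs => ?_
    rw [Measure.smul_apply, Measure.finsetSum_apply, Measure.finsetSum_apply, ENNReal.smul_def,
      smul_eq_mul]
    have h1 : (((n : ℝ≥0)⁻¹ : ℝ≥0) : ℝ≥0∞) ≤ 1 := by
      have : (1 : ℝ≥0) ≤ n := by exact_mod_cast Nat.one_le_iff_ne_zero.2 hn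
      exact_mod_cast inv_le_one_of_one_le₀ this
    calc _ ≤ 1 * ∑ i, ((h.jointLaw PX PS W).map fun q => swapEcho (q.1 i, q.2 i)) s := by gcongr
      _ ≤ _ := by
        rw [one_mul]
        exact Finset.sum_le_sum fun i _ => hρ i s
  exact ne_top_of_le_ne_top (klDiv_ne_top_of_le_smul hle)
    (echoInfo_le PS W (h.averageLaw PX PS W) (∑ i, ρ i))

/-- Converse: with `g` the density of the averaged law, `∏ᵢ g(Xᵢ, Zᵢ, Tᵢ)` has mean at most `K`
because the joint law is dominated by a law of mass `K` under which the factors are conditionally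
independent with means at most one. -/
lemma mul_echoInfo_averageLaw_le (hn : n ≠ 0) (hK : K ≠ 0) :
    n * (echoInfo PS W (h.averageLaw PX PS W)).toReal ≤ Real.log K := by
  have hprob := isProbabilityMeasure_averageLaw h PX PS W hn
  have hprob' : IsProbabilityMeasure ((h.averageLaw PX PS W).map swapEcho) :=
    Measure.isProbabilityMeasure_map measurable_swapEcho.aemeasurable
  have hprob'' : IsProbabilityMeasure ((h.averageLaw PX PS W).map swapEcho).fst := by infer_instance
  obtain ⟨g, mg, -, hg1, hg0, hgi, hgI⟩ := exists_density_of_klDiv_ne_top rfl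
    (echoInfo_averageLaw_ne_top h PX PS W hn)
  change _ = (echoInfo PS W (h.averageLaw PX PS W)).toReal at hgI
  rw [← hgI]
  obtain ⟨f, hf, hfE⟩ := (echoKernel PS W).exists_measurable_map_eq_unitInterval
  set v : Fin n → (Fin n → 𝒳 × 𝒯) × (Fin n → 𝒵) → (𝒳 × 𝒵) × 𝒯 :=
    fun i q => swapEcho (q.1 i, q.2 i)
  have mv : ∀ i, Measurable (v i) := fun i => measurable_swapEcho.comp (by fun_prop)
  set P := h.jointLaw PX PS W
  set ℓ : (𝒳 × 𝒵) × 𝒯 → ℝ := fun p => Real.log (g p).toReal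
  have mℓ : Measurable ℓ := Real.measurable_log.comp mg.ennreal_toReal
  have hn' : (n : ℝ≥0)⁻¹ ≠ 0 := inv_ne_zero (by exact_mod_cast hn)
  have eavg : (h.averageLaw PX PS W).map swapEcho = (n : ℝ≥0)⁻¹ • ∑ i, P.map (v i) :=
    averageLaw_map_swapEcho h PX PS W
  rw [eavg] at hg0 hgi ⊢
  have hgi' : ∀ i, Integrable ℓ (P.map (v i)) := by
    have := (integrable_smul_measure (c := (((n : ℝ≥0)⁻¹ : ℝ≥0) : ℝ≥0∞))
      (by exact_mod_cast hn') ENNReal.coe_ne_top).1 hgi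
    intro i
    exact (integrable_finsetSum_measure.1 this) i (Finset.mem_univ i)
  have hint : n * ∫ p, ℓ p ∂((n : ℝ≥0)⁻¹ • ∑ i, P.map (v i)) = ∫ q, ∑ i, ℓ (v i q) ∂P := by
    rw [integral_smul_nnreal_measure, integral_finsetSum_measure fun i _ => hgi' i,
      integral_finsetSum (f := fun i q => ℓ (v i q)) _ fun i _ => (hgi' i).comp_measurable (mv i),
      NNReal.smul_def, smul_eq_mul,
      ← mul_assoc]
    have : (n : ℝ) * ((n : ℝ≥0)⁻¹ : ℝ≥0) = 1 := by
      push_cast; exact mul_inv_cancel₀ (by exact_mod_cast hn)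
    rw [this, one_mul]
    exact Finset.sum_congr rfl fun i _ =>
      integral_map (mv i).aemeasurable mℓ.aestronglyMeasurable
  rw [hint]
  refine integral_le_log_of_lintegral_exp_le
    (integrable_finsetSum _ fun i _ => (hgi' i).comp_measurable (mv i))
    (by exact_mod_cast Nat.pos_of_ne_zero hK) ?_
  have hne : ∀ᵐ q ∂P, ∀ i, g (v i q) ≠ 0 ∧ g (v i q) ≠ ⊤ := by
    refine ae_all_iff.2 fun i => ae_of_ae_map (p := fun p => g p ≠ 0 ∧ g p ≠ ⊤) (mv i).aemeasurable ?_
    refine Measure.AbsolutelyContinuous.ae_le ?_ hg0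
    refine Measure.AbsolutelyContinuous.mk fun s _ hs => ?_
    rw [Measure.smul_apply, smul_eq_zero, or_iff_right hn', Measure.finsetSum_apply,
      Finset.sum_eq_zero_iff] at hs
    exact hs i (Finset.mem_univ i)
  have mprod : Measurable fun w : Fin n → (𝒳 × 𝒵) × 𝒯 => ∏ i, g (w i) := by fun_prop
  calc ∫⁻ q, ENNReal.ofReal (Real.exp (∑ i, ℓ (v i q))) ∂P
      = ∫⁻ q, ∏ i, g (v i q) ∂P := by
        refine lintegral_congr_ae (hne.mono fun q hq => ?_)
        simp only [Real.exp_sum]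
        rw [ENNReal.ofReal_prod_of_nonneg fun i _ => (Real.exp_pos _).le]
        refine Finset.prod_congr rfl fun i _ => ?_
        rw [Real.exp_log (ENNReal.toReal_pos (hq i).1 (hq i).2), ENNReal.ofReal_toReal (hq i).2]
    _ ≤ _ := lintegral_jointLaw_le h PX PS W hf hfE mprod
    _ ≤ ∫⁻ _, 1 ∂(h.dominatingLaw PX) := by
        refine lintegral_mono fun p => ?_
        have mgi : ∀ i, Measurable fun t => g ((p.1 i, p.2 i), t) := fun i => by fun_prop
        have mfi : ∀ i, Measurable (f (p.1 i)) := fun i => by fun_prop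
        rw [lintegral_pi_prod (fun _ => volume)
          (f := fun i u => g ((p.1 i, p.2 i), f (p.1 i) u)) fun i => (mgi i).comp (mfi i)]
        refine Finset.prod_le_one' fun i _ => ?_
        rw [← lintegral_map (mgi i) (mfi i), hfE]
        exact hg1 (p.1 i, p.2 i)
    _ = ENNReal.ofReal K := by
        rw [lintegral_one, dominatingLaw_univ, ENNReal.ofReal_natCast]

lemma infoRate_distortion_le [StandardBorelSpace 𝒮] [Nonempty 𝒮] [StandardBorelSpace 𝒵]
    [Nonempty 𝒵] {d : 𝒮 → 𝒵 → ℝ≥0∞} (hd : Measurable (Function.uncurry d)) (hn : n ≠ 0)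
    (hK : K ≠ 0) {D : ℝ≥0∞} (hD : h.distortion PX PS W d ≤ D) :
    infoRate PX PS W d D ≤ ENNReal.ofReal (Real.log K / n) := by
  refine (infoRate_le PX PS W hd (averageLaw_fst h PX PS W hn)
    ((lintegral_averageLaw_echoDistortion h PX PS W hd).trans_le hD)).trans ?_
  rw [← ENNReal.ofReal_toReal (echoInfo_averageLaw_ne_top h PX PS W hn)]
  refine ENNReal.ofReal_le_ofReal ?_
  rw [le_div_iff₀' (by exact_mod_cast Nat.pos_of_ne_zero hn)]
  exact mul_echoInfo_averageLaw_le h PX PS W hn hK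

end Estimator

end Converse

/-! ### Random coding -/

section RandomCoding

variable {Ω A C U : Type*} [MeasurableSpace Ω] [MeasurableSpace A] [MeasurableSpace C]
  [MeasurableSpace U]

/-- Selection of the first of finitely many sets that contains the point, and of the extra index
`Fin.last K` if there is none. -/
lemma exists_measurable_index {K : ℕ} {B : Fin K → Set Ω} (hB : ∀ k, MeasurableSet (B k)) :
    ∃ e : Ω → Fin (K + 1), Measurable e ∧
      ∀ ω, (∃ k : Fin K, e ω = k.castSucc ∧ ω ∈ B k) ∨ (e ω = Fin.last K ∧ ∀ k, ω ∉ B k) := by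
  classical
  have hp : ∀ ω, ∃ N, N = K ∨ ∃ hN : N < K, ω ∈ B ⟨N, hN⟩ := fun ω => ⟨K, Or.inl rfl⟩
  have hle : ∀ ω, Nat.find (hp ω) ≤ K := fun ω => Nat.find_min' (hp ω) (Or.inl rfl)
  have hm : Measurable fun ω => Nat.find (hp ω) := by
    refine measurable_find hp fun N => ?_
    by_cases hN : N < K
    · rcases eq_or_ne N K with h | h
      · omega
      · simpa [h, hN] using hB ⟨N, hN⟩
    · by_cases h : N = K
      · simp [h]
      · simp [h, hN]
  refine ⟨fun ω => Fin.ofNat (K + 1) (Nat.find (hp ω)), ?_, fun ω => ?_⟩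
  · exact (measurable_of_countable fun m : ℕ => Fin.ofNat (K + 1) m).comp hm
  · have hval : (Fin.ofNat (K + 1) (Nat.find (hp ω))).val = Nat.find (hp ω) :=
      Nat.mod_eq_of_lt (Nat.lt_succ_of_le (hle ω))
    rcases Nat.find_spec (hp ω) with h | ⟨hN, hω⟩
    · refine Or.inr ⟨Fin.ext (by rw [hval, h]; rfl), fun k hk => ?_⟩
      have := Nat.find_min' (hp ω) (Or.inr ⟨k.2, hk⟩)
      omega
    · exact Or.inl ⟨⟨_, hN⟩, Fin.ext (by rw [hval]; rfl), hω⟩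

/-- The decoder of a codebook `c`, whose last index is reserved for the fallback `z₀`. -/
def codebookDecoder {K : ℕ} (φ : A → U → C) (z₀ : C) (c : Fin K → U) (p : A × Fin (K + 1)) : C :=
  Fin.lastCases z₀ (fun k => φ p.1 (c k)) p.2

lemma measurable_codebookDecoder {K : ℕ} {φ : A → U → C} (hφ : Measurable (Function.uncurry φ))
    (z₀ : C) (c : Fin K → U) : Measurable (codebookDecoder φ z₀ c) := by
  refine measurable_from_prod_countable_left fun w => ?_
  induction w using Fin.lastCases with
  | last => simp [codebookDecoder]
  | cast k =>
    simp only [codebookDecoder, Fin.lastCases_castSucc]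
    fun_prop

/-- One-shot random coding. If the `K` codewords are drawn independently, the encoder fails to find
a codeword in the good set `G` only if all of them miss it; some codebook is at least as good as the
average. -/
lemma exists_codebook {K : ℕ} (μ : Measure Ω) [IsProbabilityMeasure μ] (lam : Measure U)
    [IsProbabilityMeasure lam] {π : Ω → A} (hπ : Measurable π) {φ : A → U → C}
    (hφ : Measurable (Function.uncurry φ)) {G : Set (Ω × C)} (hG : MeasurableSet G)
    {ρ : Ω × C → ℝ≥0∞} (hρ : Measurable ρ) {D : ℝ≥0∞} (hD : ∀ p ∈ G, ρ p ≤ D) (z₀ : C) :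
    ∃ (c : Fin K → U) (e : Ω → Fin (K + 1)), Measurable e ∧
      ∫⁻ ω, ρ (ω, codebookDecoder φ z₀ c (π ω, e ω)) ∂μ ≤
        D + ∫⁻ ω, ρ (ω, z₀) * (∫⁻ u, Gᶜ.indicator 1 (ω, φ (π ω) u) ∂lam) ^ K ∂μ := by
  have mI : Measurable (Gᶜ.indicator (1 : Ω × C → ℝ≥0∞)) := measurable_one.indicator hG.compl
  have mρ0 : Measurable fun ω => ρ (ω, z₀) := by fun_prop
  set J : (Fin K → U) → ℝ≥0∞ := fun c =>
    ∫⁻ ω, ρ (ω, z₀) * ∏ k, Gᶜ.indicator 1 (ω, φ (π ω) (c k)) ∂μ with hJ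
  have mJ' : Measurable fun q : (Fin K → U) × Ω =>
      ρ (q.2, z₀) * ∏ k, Gᶜ.indicator (1 : Ω × C → ℝ≥0∞) (q.2, φ (π q.2) (q.1 k)) := by
    refine (by fun_prop : Measurable fun q : (Fin K → U) × Ω => ρ (q.2, z₀)).mul
      (Finset.measurable_prod _ fun k _ => mI.comp (by fun_prop))
  have mJ : Measurable J := mJ'.lintegral_prod_right'
  obtain ⟨c, hc⟩ := exists_le_lintegral (μ := Measure.pi fun _ : Fin K => lam) mJ.aemeasurable
  have hJint : ∫⁻ c, J c ∂(Measure.pi fun _ : Fin K => lam) =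
      ∫⁻ ω, ρ (ω, z₀) * (∫⁻ u, Gᶜ.indicator 1 (ω, φ (π ω) u) ∂lam) ^ K ∂μ := by
    rw [hJ, lintegral_lintegral_swap mJ'.aemeasurable]
    refine lintegral_congr fun ω => ?_
    have mIω : Measurable fun u => Gᶜ.indicator (1 : Ω × C → ℝ≥0∞) (ω, φ (π ω) u) :=
      mI.comp (by fun_prop)
    have mIp : Measurable fun c : Fin K → U =>
        ∏ k, Gᶜ.indicator (1 : Ω × C → ℝ≥0∞) (ω, φ (π ω) (c k)) :=
      Finset.measurable_prod _ fun k _ => mIω.comp (measurable_pi_apply k)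
    rw [lintegral_const_mul _ mIp, lintegral_pi_prod (fun _ => lam)
      (f := fun _ u => Gᶜ.indicator (1 : Ω × C → ℝ≥0∞) (ω, φ (π ω) u)) fun _ => mIω]
    simp
  obtain ⟨e, me, he⟩ := exists_measurable_index (B := fun k => {ω | (ω, φ (π ω) (c k)) ∈ G})
    fun k => hG.mem.setOf.preimage (by fun_prop : Measurable fun ω => (ω, φ (π ω) (c k)))
  refine ⟨c, e, me, ?_⟩
  calc ∫⁻ ω, ρ (ω, codebookDecoder φ z₀ c (π ω, e ω)) ∂μ
      ≤ ∫⁻ ω, (D + ρ (ω, z₀) * ∏ k, Gᶜ.indicator 1 (ω, φ (π ω) (c k))) ∂μ := by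
        refine lintegral_mono fun ω => ?_
        rcases he ω with ⟨k, hk, hω⟩ | ⟨hk, hω⟩
        · rw [hk, codebookDecoder]
          simp only [Fin.lastCases_castSucc]
          exact (hD _ hω).trans le_self_add
        · rw [hk, codebookDecoder]
          simp only [Fin.lastCases_last]
          have : ∏ k, Gᶜ.indicator (1 : Ω × C → ℝ≥0∞) (ω, φ (π ω) (c k)) = 1 :=
            Finset.prod_eq_one fun k _ => by
              rw [Set.indicator_of_mem (show (ω, φ (π ω) (c k)) ∈ Gᶜ from hω k)]; rfl
          rw [this, mul_one]
          exact le_add_self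
    _ = D + J c := by
        rw [lintegral_add_left measurable_const]; simp [hJ]
    _ ≤ _ := by
        rw [← hJint]
        gcongr

/-- If each of `K` independent trials succeeds with probability `α ≥ b / L`, all of them fail with
probability at most `1 - b + exp (-K / L)`. -/
lemma one_sub_pow_le {α b L : ℝ} (K : ℕ) (hα : α ≤ 1) (hb0 : 0 ≤ b) (hb1 : b ≤ 1)
    (hL : 0 < L) (hbα : b ≤ L * α) : (1 - α) ^ K ≤ 1 - b + Real.exp (-(K / L)) := by
  have h1 : (1 - α) ^ K ≤ Real.exp (-(K * α)) := by
    have : 1 - α ≤ Real.exp (-α) := by linarith [Real.add_one_le_exp (-α)]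
    calc (1 - α) ^ K ≤ Real.exp (-α) ^ K := pow_le_pow_left₀ (by linarith) this K
      _ = _ := by rw [← Real.exp_nat_mul]; ring_nf
  have h2 : Real.exp (-(K * α)) ≤ Real.exp (b * (-(K / L)) + (1 - b) * 0) := by
    refine Real.exp_le_exp.2 ?_
    have : b / L ≤ α := by rw [div_le_iff₀ hL]; linarith
    have := mul_le_mul_of_nonneg_left this (Nat.cast_nonneg (α := ℝ) K)
    have e : (K : ℝ) * (b / L) = b * (K / L) := by ring
    linarith
  have h3 := convexOn_exp.2 (Set.mem_univ (-(K / L : ℝ))) (Set.mem_univ 0) hb0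
    (by linarith : (0 : ℝ) ≤ 1 - b) (by ring)
  simp only [smul_eq_mul, Real.exp_zero] at h3
  have h4 : b * Real.exp (-(K / L)) ≤ 1 * Real.exp (-(K / L)) := by gcongr
  linarith

end RandomCoding

section Achievability

variable {𝒳 𝒮 𝒯 𝒵 : Type*} [MeasurableSpace 𝒳] [MeasurableSpace 𝒮] [MeasurableSpace 𝒯]
  [MeasurableSpace 𝒵]

/-- The estimator with a given deterministic encoder and decoder. -/
def Estimator.deterministic {n K : ℕ} {e : (Fin n → 𝒳 × 𝒯) → Fin K} (he : Measurable e)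
    {ψ : (Fin n → 𝒳) × Fin K → Fin n → 𝒵} (hψ : Measurable ψ) : Estimator 𝒳 𝒯 𝒵 n K where
  enc := Kernel.deterministic (fun p => e fun i => (p.1 i, p.2 i)) (he.comp (by fun_prop))
  dec := Kernel.deterministic ψ hψ
  markov_enc := inferInstance
  markov_dec := inferInstance

lemma Estimator.lintegral_channel_deterministic {n K : ℕ} {e : (Fin n → 𝒳 × 𝒯) → Fin K}
    (he : Measurable e) {ψ : (Fin n → 𝒳) × Fin K → Fin n → 𝒵} (hψ : Measurable ψ)
    (a : Fin n → 𝒳 × 𝒯) {F : (Fin n → 𝒵) → ℝ≥0∞} (hF : Measurable F) :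
    ∫⁻ z, F z ∂((Estimator.deterministic he hψ).channel a) =
      F (ψ (fun i => (a i).1, e a)) := by
  rw [lintegral_channel _ a hF]
  have he' : Measurable fun p : (Fin n → 𝒳) × (Fin n → 𝒯) => e fun i => (p.1 i, p.2 i) :=
    he.comp (by fun_prop)
  simp only [Estimator.deterministic]
  rw [Kernel.deterministic_apply he',
    lintegral_dirac' _ (measurable_of_countable _), Kernel.deterministic_apply,
    lintegral_dirac' _ hF]

variable (PX : Measure 𝒳) [IsProbabilityMeasure PX] (PS : Measure 𝒮) [IsProbabilityMeasure PS]
  (W : Kernel (𝒳 × 𝒮) 𝒯) [IsMarkovKernel W] [StandardBorelSpace 𝒮] [Nonempty 𝒮]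

/-- Block random coding, with the codewords drawn from the memoryless channel `q`: if `g` is a
density of `m ⊗ₘ Q` with respect to `m ⊗ₘ q`, `m = P_{XT}`, that is at most `L` on the good set,
the excess distortion is controlled by the probability of leaving the good set. -/
lemma exists_estimator {n : ℕ} (hn : n ≠ 0) (K : ℕ) {d : 𝒮 → 𝒵 → ℝ≥0∞}
    (hd : Measurable (Function.uncurry d)) (q : Kernel 𝒳 𝒵) [IsMarkovKernel q]
    [StandardBorelSpace 𝒵] [Nonempty 𝒵] (Q : Kernel (𝒳 × 𝒯) 𝒵) [IsMarkovKernel Q]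
    {g : (𝒳 × 𝒯) × 𝒵 → ℝ≥0∞} (hg : Measurable g)
    (hQ : echoLaw PX PS W ⊗ₘ Q = (echoLaw PX PS W ⊗ₘ q.prodMkRight 𝒯).withDensity g)
    (hg1 : ∀ a : 𝒳 × 𝒯, ∫⁻ z, g (a, z) ∂(q a.1) ≤ 1)
    {G : Set (Fin n → (𝒳 × 𝒯) × 𝒵)} (hG : MeasurableSet G) {L : ℝ} (hL : 0 < L)
    (hGL : ∀ p ∈ G, ∏ i, g (p i) ≤ ENNReal.ofReal L) {D : ℝ≥0∞}
    (hGD : ∀ p ∈ G, (∑ i, echoDistortion PX PS W d (p i)) / n ≤ D) (z₀ : 𝒵) (M : ℝ≥0∞) :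
    ∃ h : Estimator 𝒳 𝒯 𝒵 n (K + 1), h.distortion PX PS W d ≤
      D + M * (Measure.pi fun _ : Fin n => echoLaw PX PS W ⊗ₘ Q) Gᶜ +
        ∫⁻ a, (echoDistortion PX PS W d (a, z₀) - M) ∂(echoLaw PX PS W) +
        ENNReal.ofReal (Real.exp (-(K / L))) *
          ∫⁻ a, echoDistortion PX PS W d (a, z₀) ∂(echoLaw PX PS W) := by
  set m := echoLaw PX PS W with hm
  set δ := echoDistortion PX PS W d with hδ
  have mδ : Measurable δ := measurable_echoDistortion PX PS W hd
  obtain ⟨f, hf, hfq⟩ := q.exists_measurable_map_eq_unitInterval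
  set μ : Measure (Fin n → 𝒳 × 𝒯) := Measure.pi fun _ => m
  set lam : Measure (Fin n → unitInterval) := Measure.pi fun _ => volume
  -- the block `((xᵢ, tᵢ), f(xᵢ, uᵢ))`
  set τ : (Fin n → 𝒳 × 𝒯) → (Fin n → unitInterval) → Fin n → (𝒳 × 𝒯) × 𝒵 :=
    fun a u i => (a i, f (a i).1 (u i)) with hτ
  have mτ : Measurable (Function.uncurry τ) := by
    simp only [hτ, Function.uncurry_def]
    fun_prop
  have mτa : ∀ a, Measurable (τ a) := fun a => by fun_prop
  set β : (Fin n → 𝒳 × 𝒯) → ℝ≥0∞ := fun a => ∫⁻ u, Gᶜ.indicator 1 (τ a u) ∂lam with hβ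
  set b : (Fin n → 𝒳 × 𝒯) → ℝ≥0∞ := fun a =>
    ∫⁻ u, G.indicator (fun p => ∏ i, g (p i)) (τ a u) ∂lam with hb
  have mprod : Measurable fun p : Fin n → (𝒳 × 𝒯) × 𝒵 => ∏ i, g (p i) := by fun_prop
  have mGg : Measurable (G.indicator fun p : Fin n → (𝒳 × 𝒯) × 𝒵 => ∏ i, g (p i)) :=
    mprod.indicator hG
  have mb : Measurable b := (mGg.comp mτ).lintegral_prod_right'
  have hb1 : ∀ a, b a ≤ 1 := fun a => by
    have mga : ∀ i, Measurable fun z => g (a i, z) := fun i => by fun_prop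
    have mfa : ∀ i, Measurable (f (a i).1) := fun i => by fun_prop
    calc b a ≤ ∫⁻ u, ∏ i, g (a i, f (a i).1 (u i)) ∂lam :=
          lintegral_mono fun u => Set.indicator_le_self G (fun p => ∏ i, g (p i)) (τ a u)
      _ = ∏ i, ∫⁻ v, g (a i, f (a i).1 v) ∂volume :=
          lintegral_pi_prod (fun _ => volume) (f := fun i v => g (a i, f (a i).1 v))
            fun i => (mga i).comp (mfa i)
      _ ≤ 1 := Finset.prod_le_one' fun i _ => by
          rw [← lintegral_map (mga i) (mfa i), hfq]
          exact hg1 (a i)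
  -- the mean of `b` is the probability of the good set
  have hbint : ∫⁻ a, (1 - b a) ∂μ = (Measure.pi fun _ : Fin n => m ⊗ₘ Q) Gᶜ := by
    have hQp : IsProbabilityMeasure ((m ⊗ₘ q.prodMkRight 𝒯).withDensity g) := by
      rw [← hQ]; infer_instance
    have e1 : ∫⁻ a, b a ∂μ = (Measure.pi fun _ : Fin n => m ⊗ₘ Q) G := by
      rw [hQ, pi_withDensity _ hg, withDensity_apply _ hG, ← lintegral_indicator hG,
        lintegral_pi_compProd m _ (f := fun a => f a.1) (by fun_prop) (fun a => hfq a.1) mGg]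
    rw [lintegral_sub mb ((lintegral_mono hb1).trans_lt (by simp)).ne (ae_of_all _ hb1), e1,
      lintegral_one, measure_univ, prob_compl_eq_one_sub hG]
  have hβb : ∀ a, β a ^ K ≤ (1 - b a) + ENNReal.ofReal (Real.exp (-(K / L))) := fun a => by
    set α : ℝ≥0∞ := ∫⁻ u, G.indicator 1 (τ a u) ∂lam with hα
    have mI : Measurable fun u => G.indicator (1 : (Fin n → (𝒳 × 𝒯) × 𝒵) → ℝ≥0∞) (τ a u) :=
      (measurable_one.indicator hG).comp (mτa a)
    have hαβ : α + β a = 1 := by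
      rw [hα, hβ, ← lintegral_add_left mI]
      have : ∀ u, G.indicator (1 : (Fin n → (𝒳 × 𝒯) × 𝒵) → ℝ≥0∞) (τ a u) +
          Gᶜ.indicator 1 (τ a u) = 1 := fun u => by
        by_cases h : τ a u ∈ G <;> simp [h]
      simp [this]
    have hbα : b a ≤ ENNReal.ofReal L * α := by
      rw [hα, ← lintegral_const_mul _ mI]
      refine lintegral_mono fun u => ?_
      by_cases h : τ a u ∈ G
      · simpa [h] using hGL _ h
      · simp [h]
    have hα1 : α ≤ 1 := hαβ ▸ le_self_add
    have hαt : α ≠ ⊤ := (hα1.trans_lt ENNReal.one_lt_top).ne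
    have hbt : b a ≠ ⊤ := ((hb1 a).trans_lt ENNReal.one_lt_top).ne
    have hβ' : β a = ENNReal.ofReal (1 - α.toReal) := by
      rw [ENNReal.ofReal_sub _ ENNReal.toReal_nonneg, ENNReal.ofReal_toReal hαt,
        ENNReal.ofReal_one, ← hαβ, ENNReal.add_sub_cancel_left hαt]
    have hb' : 1 - b a = ENNReal.ofReal (1 - (b a).toReal) := by
      rw [ENNReal.ofReal_sub _ ENNReal.toReal_nonneg, ENNReal.ofReal_toReal hbt, ENNReal.ofReal_one]
    have hα1' : α.toReal ≤ 1 := ENNReal.toReal_le_of_le_ofReal zero_le_one (by simpa using hα1)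
    have hb1' : (b a).toReal ≤ 1 :=
      ENNReal.toReal_le_of_le_ofReal zero_le_one (by simpa using hb1 a)
    rw [hβ', hb', ← ENNReal.ofReal_pow (by linarith), ← ENNReal.ofReal_add (by linarith)
      (Real.exp_pos _).le]
    refine ENNReal.ofReal_le_ofReal (one_sub_pow_le K hα1' ENNReal.toReal_nonneg hb1' hL ?_)
    have := ENNReal.toReal_mono (ENNReal.mul_ne_top ENNReal.ofReal_ne_top hαt) hbα
    rwa [ENNReal.toReal_mul, ENNReal.toReal_ofReal hL.le] at this
  set ρ : (Fin n → 𝒳 × 𝒯) × (Fin n → 𝒵) → ℝ≥0∞ := fun p => (∑ i, δ (p.1 i, p.2 i)) / n with hρ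
  have mρ : Measurable ρ := by fun_prop
  have mzip : Measurable fun p : (Fin n → 𝒳 × 𝒯) × (Fin n → 𝒵) => fun i => (p.1 i, p.2 i) := by
    fun_prop
  obtain ⟨c, e, me, hce⟩ := exists_codebook (K := K) μ lam
    (π := fun a : Fin n → 𝒳 × 𝒯 => fun i => (a i).1) (by fun_prop)
    (φ := fun (x : Fin n → 𝒳) u i => f (x i) (u i))
    (by simp only [Function.uncurry_def]; fun_prop)
    (G := {p | (fun i => (p.1 i, p.2 i)) ∈ G}) (mzip hG) mρ (D := D)
    (fun p hp => hGD _ hp) (fun _ => z₀)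
  refine ⟨Estimator.deterministic me (measurable_codebookDecoder (K := K)
    (φ := fun (x : Fin n → 𝒳) u i => f (x i) (u i))
    (by simp only [Function.uncurry_def]; fun_prop) (fun _ => z₀) c), ?_⟩
  rw [Estimator.distortion_eq _ PX PS W hd]
  have hn0 : (n : ℝ≥0∞) ≠ 0 := by exact_mod_cast hn
  have hnt : (n : ℝ≥0∞) ≠ ⊤ := ENNReal.natCast_ne_top n
  have mδ0 : Measurable fun a => δ (a, z₀) := by fun_prop
  set ρ₀ : (Fin n → 𝒳 × 𝒯) → ℝ≥0∞ := fun a => ρ (a, fun _ => z₀) with hρ₀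
  have mρ₀ : Measurable ρ₀ := by fun_prop
  have havg : ∀ F : 𝒳 × 𝒯 → ℝ≥0∞, Measurable F → ∫⁻ a, (∑ i, F (a i)) / n ∂μ = ∫⁻ a, F a ∂m := by
    intro F hF
    simp only [div_eq_mul_inv]
    rw [lintegral_mul_const _ (by fun_prop), lintegral_finsetSum _ fun i _ => by fun_prop]
    have : ∀ i, ∫⁻ a, F (a i) ∂μ = ∫⁻ a, F a ∂m := fun i => lintegral_pi_eval _ i hF
    simp only [this, Finset.sum_const, Finset.card_univ, Fintype.card_fin, nsmul_eq_mul]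
    rw [mul_comm, ← mul_assoc, ENNReal.inv_mul_cancel hn0 hnt, one_mul]
  have hρ₀M : ∀ a, ρ₀ a ≤ M + (∑ i, (δ (a i, z₀) - M)) / n := fun a => by
    have : M = (∑ _i : Fin n, M) / n := by
      rw [Finset.sum_const, Finset.card_univ, Fintype.card_fin, nsmul_eq_mul, mul_comm,
        ENNReal.mul_div_cancel_right hn0 hnt]
    conv_rhs => rw [this]
    rw [← ENNReal.add_div, ← Finset.sum_add_distrib]
    refine ENNReal.div_le_div_right (Finset.sum_le_sum fun i _ => ?_) _
    rw [← this]
    exact le_add_tsub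
  calc ∫⁻ a, ∫⁻ z, (∑ i, δ (a i, z i)) / n ∂((Estimator.deterministic me _).channel a) ∂μ
      = ∫⁻ a, ρ (a, codebookDecoder (fun (x : Fin n → 𝒳) u i => f (x i) (u i)) (fun _ => z₀) c
          (fun i => (a i).1, e a)) ∂μ := by
        refine lintegral_congr fun a => ?_
        rw [Estimator.lintegral_channel_deterministic _ _ _ (by fun_prop)]
    _ ≤ D + ∫⁻ a, ρ₀ a * β a ^ K ∂μ := hce
    _ ≤ D + ∫⁻ a, ((M * (1 - b a) + (∑ i, (δ (a i, z₀) - M)) / n) +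
          ENNReal.ofReal (Real.exp (-(K / L))) * ρ₀ a) ∂μ := by
        gcongr with a
        calc ρ₀ a * β a ^ K ≤ ρ₀ a * ((1 - b a) + ENNReal.ofReal (Real.exp (-(K / L)))) := by
              gcongr; exact hβb a
          _ = ρ₀ a * (1 - b a) + ENNReal.ofReal (Real.exp (-(K / L))) * ρ₀ a := by
              rw [mul_add, mul_comm (ρ₀ a) (ENNReal.ofReal _)]
          _ ≤ (M + (∑ i, (δ (a i, z₀) - M)) / n) * (1 - b a) +
                ENNReal.ofReal (Real.exp (-(K / L))) * ρ₀ a := by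
              gcongr; exact hρ₀M a
          _ ≤ _ := by
              rw [add_mul]
              gcongr
              exact mul_le_of_le_one_right' tsub_le_self
    _ = _ := by
        rw [lintegral_add_left (by fun_prop), lintegral_add_left (by fun_prop),
          lintegral_const_mul _ (by fun_prop), lintegral_const_mul _ mρ₀, hbint,
          havg (fun a => δ (a, z₀) - M) (by fun_prop), havg (fun a => δ (a, z₀)) mδ0]
        ring

end Achievability

section AchievabilityLimit

open InformationTheory

variable {𝒳 𝒮 𝒯 𝒵 : Type*} [MeasurableSpace 𝒳] [MeasurableSpace 𝒮] [MeasurableSpace 𝒯]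
  [MeasurableSpace 𝒵]

lemma tendsto_lintegral_tsub_natCast {α : Type*} [MeasurableSpace α] {μ : Measure α}
    {f : α → ℝ≥0∞} (hf : Measurable f) (hfi : ∫⁻ a, f a ∂μ ≠ ⊤) :
    Tendsto (fun k : ℕ => ∫⁻ a, (f a - k) ∂μ) atTop (𝓝 0) := by
  have h := tendsto_lintegral_of_dominated_convergence (μ := μ) (F := fun (k : ℕ) a => f a - k)
    (f := fun _ => 0) f (fun k => by fun_prop) (fun k => ae_of_all _ fun a => tsub_le_self) hfi
    (by
      filter_upwards [ae_lt_top hf hfi] with a ha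
      obtain ⟨N, hN⟩ := ENNReal.exists_nat_gt ha.ne
      refine tendsto_const_nhds.congr' ?_
      filter_upwards [eventually_ge_atTop N] with k hk
      exact (tsub_eq_zero_of_le (hN.le.trans (by exact_mod_cast hk))).symm)
  simpa using h

/-- The law of large numbers for typical blocks: both the information density `log g` and the
distortion `δ` have averages close to their means. -/
lemma tendsto_pi_measure_compl_typical {α : Type*} [MeasurableSpace α] (P : Measure α)
    [IsProbabilityMeasure P] {g δ : α → ℝ≥0∞} (hg : Measurable g) (hδ : Measurable δ)
    (hg0 : ∀ᵐ p ∂P, g p ≠ 0 ∧ g p ≠ ⊤) (hgi : Integrable (fun p => Real.log (g p).toReal) P)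
    (hδi : ∫⁻ p, δ p ∂P ≠ ⊤) {γ c : ℝ} (hγ : ∫ p, Real.log (g p).toReal ∂P < γ)
    (hc : (∫⁻ p, δ p ∂P).toReal < c) :
    Tendsto (fun n : ℕ => (Measure.pi fun _ : Fin n => P)
      {p | ∏ i, g (p i) ≤ ENNReal.ofReal (Real.exp (n * γ)) ∧
        (∑ i, δ (p i)) / n ≤ ENNReal.ofReal c}ᶜ) atTop (𝓝 0) := by
  have hδt := ae_lt_top hδ hδi
  have hint : ∫ p, (δ p).toReal ∂P = (∫⁻ p, δ p ∂P).toReal :=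
    integral_toReal hδ.aemeasurable hδt
  have h1 := tendsto_pi_measure_sum_gt P (Real.measurable_log.comp hg.ennreal_toReal) hgi hγ
  have h2 := tendsto_pi_measure_sum_gt P hδ.ennreal_toReal
    (integrable_toReal_of_lintegral_ne_top hδ.aemeasurable hδi) (c := c) (by rw [hint]; exact hc)
  have h3 := h1.add h2
  rw [add_zero] at h3
  refine tendsto_of_tendsto_of_tendsto_of_le_of_le' tendsto_const_nhds h3
    (Eventually.of_forall fun _ => zero_le) ?_
  filter_upwards [eventually_gt_atTop 0] with n hn
  refine le_trans (measure_mono_ae ?_) (measure_union_le _ _)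
  have hae : ∀ᵐ p ∂(Measure.pi fun _ : Fin n => P), ∀ i, (g (p i) ≠ 0 ∧ g (p i) ≠ ⊤) ∧ δ (p i) < ⊤ :=
    ae_all_iff.2 fun i =>
      (measurePreserving_eval (fun _ : Fin n => P) i).quasiMeasurePreserving.ae (hg0.and hδt)
  filter_upwards [hae] with p hp hpG
  by_contra hcon
  refine hpG ?_
  have hcon' : ¬ ((n : ℝ) * γ < ∑ i, Real.log (g (p i)).toReal) ∧
      ¬ ((n : ℝ) * c < ∑ i, (δ (p i)).toReal) := ⟨fun h => hcon (Or.inl h), fun h => hcon (Or.inr h)⟩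
  obtain ⟨hA, hB⟩ := hcon'
  rw [not_lt] at hA hB
  have hn' : (0 : ℝ) < n := by exact_mod_cast hn
  constructor
  · have e : ∏ i, g (p i) = ENNReal.ofReal (Real.exp (∑ i, Real.log (g (p i)).toReal)) := by
      rw [Real.exp_sum, ENNReal.ofReal_prod_of_nonneg fun i _ => (Real.exp_pos _).le]
      refine Finset.prod_congr rfl fun i _ => ?_
      rw [Real.exp_log (ENNReal.toReal_pos (hp i).1.1 (hp i).1.2), ENNReal.ofReal_toReal (hp i).1.2]
    rw [e]
    exact ENNReal.ofReal_le_ofReal (Real.exp_le_exp.2 hA)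
  · have e : ∑ i, δ (p i) = ENNReal.ofReal (∑ i, (δ (p i)).toReal) := by
      rw [ENNReal.ofReal_sum_of_nonneg fun i _ => ENNReal.toReal_nonneg]
      exact Finset.sum_congr rfl fun i _ => (ENNReal.ofReal_toReal (hp i).2.ne).symm
    rw [e, ← ENNReal.ofReal_natCast n, ← ENNReal.ofReal_div_of_pos hn']
    refine ENNReal.ofReal_le_ofReal ?_
    rwa [div_le_iff₀' hn']

/-- The number of indices used by random coding at rate `γ`. -/
def codeSize (γ : ℝ) (n : ℕ) : ℕ := ⌈Real.exp (n * γ)⌉₊ + 1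

variable (PX : Measure 𝒳) [IsProbabilityMeasure PX] (PS : Measure 𝒮) [IsProbabilityMeasure PS]
  (W : Kernel (𝒳 × 𝒮) 𝒯) [IsMarkovKernel W] [StandardBorelSpace 𝒮] [Nonempty 𝒮]
  [StandardBorelSpace 𝒵] [Nonempty 𝒵]

lemma eventually_exists_estimator {d : 𝒮 → 𝒵 → ℝ≥0∞} (hd : Measurable (Function.uncurry d))
    {z₀ : 𝒵} (hz₀ : ∫⁻ s, d s z₀ ∂PS ≠ ⊤) (Q : Kernel (𝒳 × 𝒯) 𝒵) [IsMarkovKernel Q]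
    (hQD : letterDistortion PX PS W d Q ≠ ⊤) {γ : ℝ}
    (hγ : condMutualInfo PX PS W Q < ENNReal.ofReal γ) {ε : ℝ≥0} (hε : 0 < ε) :
    ∀ᶠ n : ℕ in atTop, ∃ h : Estimator 𝒳 𝒯 𝒵 n (codeSize γ n),
      h.distortion PX PS W d ≤ letterDistortion PX PS W d Q + ε := by
  set m := echoLaw PX PS W with hm
  set q := reconKernel PS W Q
  set δ := echoDistortion PX PS W d with hδ
  have mδ : Measurable δ := measurable_echoDistortion PX PS W hd
  obtain ⟨g, mg, hQ, hg1, hg0, hgi, hgI⟩ := exists_density_of_klDiv_ne_top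
    (Measure.fst_compProd m Q) (hγ.trans_le le_top).ne
  change _ = (condMutualInfo PX PS W Q).toReal at hgI
  have hIγ : (condMutualInfo PX PS W Q).toReal < γ := by
    have hγ0 : 0 < γ := ENNReal.ofReal_pos.1 (zero_le.trans_lt hγ)
    have := ENNReal.toReal_strict_mono ENNReal.ofReal_ne_top hγ
    rwa [ENNReal.toReal_ofReal hγ0.le] at this
  obtain ⟨γ', hγ'1, hγ'2⟩ := exists_between hIγ
  set D₀ := letterDistortion PX PS W d Q with hD₀
  have hD₀' : ∫⁻ p, δ p ∂(m ⊗ₘ Q) = D₀ := (letterDistortion_eq PX PS W hd Q).symm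
  set η : ℝ≥0 := ε / 4 with hη
  have hηpos : 0 < η := by positivity
  have hηpos' : (0 : ℝ≥0∞) < η := by exact_mod_cast hηpos
  set c₀ := ∫⁻ a, δ (a, z₀) ∂m with hc₀
  have hc₀t : c₀ ≠ ⊤ := by rw [hc₀, hδ, hm, lintegral_echoDistortion_const PX PS W hd]; exact hz₀
  have mδ0 : Measurable fun a => δ (a, z₀) := by fun_prop
  obtain ⟨M, hM⟩ := ((tendsto_lintegral_tsub_natCast mδ0 hc₀t).eventually_lt_const hηpos').exists
  have hG := tendsto_pi_measure_compl_typical (m ⊗ₘ Q) mg mδ hg0 hgi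
    (by rw [hD₀']; exact hQD) (γ := γ') (c := D₀.toReal + η) (by rw [hgI]; exact hγ'1)
    (by rw [hD₀']; exact lt_add_of_pos_right _ (by exact_mod_cast hηpos))
  have hMG := ENNReal.Tendsto.const_mul (a := (M : ℝ≥0∞)) hG (Or.inr (ENNReal.natCast_ne_top M))
  rw [mul_zero] at hMG
  have hexp : Tendsto (fun n : ℕ => ENNReal.ofReal (Real.exp (-(n * (γ - γ')))) * c₀) atTop
      (𝓝 0) := by
    have h1 : Tendsto (fun n : ℕ => Real.exp (-(n * (γ - γ')))) atTop (𝓝 0) :=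
      Real.tendsto_exp_neg_atTop_nhds_zero.comp
        (tendsto_natCast_atTop_atTop.atTop_mul_const (by linarith : 0 < γ - γ'))
    have h2 := ENNReal.Tendsto.mul_const (ENNReal.tendsto_ofReal h1) (b := c₀) (Or.inr hc₀t)
    simpa using h2
  filter_upwards [hMG.eventually_lt_const hηpos', hexp.eventually_lt_const hηpos',
    eventually_gt_atTop 0] with n hn1 hn2 hn0
  have mA : MeasurableSet {p : Fin n → (𝒳 × 𝒯) × 𝒵 |
      ∏ i, g (p i) ≤ ENNReal.ofReal (Real.exp (n * γ'))} :=
    measurableSet_le (by fun_prop) measurable_const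
  have mB : MeasurableSet {p : Fin n → (𝒳 × 𝒯) × 𝒵 |
      (∑ i, δ (p i)) / n ≤ ENNReal.ofReal (D₀.toReal + η)} :=
    measurableSet_le (by fun_prop) measurable_const
  have mG : MeasurableSet {p : Fin n → (𝒳 × 𝒯) × 𝒵 |
      ∏ i, g (p i) ≤ ENNReal.ofReal (Real.exp (n * γ')) ∧
        (∑ i, δ (p i)) / n ≤ ENNReal.ofReal (D₀.toReal + η)} :=
    mA.inter mB
  obtain ⟨h, hh⟩ := exists_estimator PX PS W hn0.ne' ⌈Real.exp (n * γ)⌉₊ hd q Q mg hQ hg1 mG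
    (Real.exp_pos (n * γ')) (fun p hp => hp.1) (fun p hp => hp.2) z₀ M
  refine ⟨h, hh.trans ?_⟩
  have hK : Real.exp (-(⌈Real.exp (n * γ)⌉₊ / Real.exp (n * γ'))) ≤
      Real.exp (-(n * (γ - γ'))) := by
    refine Real.exp_le_exp.2 (neg_le_neg ?_)
    calc n * (γ - γ') ≤ Real.exp (n * (γ - γ')) := by
          linarith [Real.add_one_le_exp (n * (γ - γ'))]
      _ = Real.exp (n * γ) / Real.exp (n * γ') := by rw [← Real.exp_sub]; ring_nf
      _ ≤ _ := by gcongr; exact Nat.le_ceil _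
  have hD : ENNReal.ofReal (D₀.toReal + η) = D₀ + η := by
    rw [ENNReal.ofReal_add ENNReal.toReal_nonneg η.coe_nonneg, ENNReal.ofReal_toReal hQD,
      ENNReal.ofReal_coe_nnreal]
  calc _ ≤ (D₀ + η) + η + η + η := by
        refine add_le_add (add_le_add (add_le_add hD.le hn1.le) hM.le) (le_trans ?_ hn2.le)
        gcongr
    _ = D₀ + ((η + η + η + η : ℝ≥0) : ℝ≥0∞) := by push_cast; ring
    _ = D₀ + ε := by
        congr 2
        rw [hη, ← NNReal.coe_inj]; push_cast; ring

/-- Achievability: any rate above `I(T; Z | X)` suffices to approach the distortion of a channel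
`P_{Z|XT}`. The number of indices does not depend on how closely it is approached, so a
near-optimal estimator can be taken at each block length. -/
lemma exists_estimator_seq {d : 𝒮 → 𝒵 → ℝ≥0∞} (hd : Measurable (Function.uncurry d))
    {z₀ : 𝒵} (hz₀ : ∫⁻ s, d s z₀ ∂PS ≠ ⊤) (Q : Kernel (𝒳 × 𝒯) 𝒵) [IsMarkovKernel Q]
    (hQD : letterDistortion PX PS W d Q ≠ ⊤) {γ : ℝ}
    (hγ : condMutualInfo PX PS W Q < ENNReal.ofReal γ) :
    ∃ h : ∀ n, Estimator 𝒳 𝒯 𝒵 n (codeSize γ n),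
      limsup (fun n => (h n).distortion PX PS W d) atTop ≤ letterDistortion PX PS W d Q := by
  have hpick : ∀ n : ℕ, ∃ h : Estimator 𝒳 𝒯 𝒵 n (codeSize γ n),
      h.distortion PX PS W d ≤
        (⨅ h' : Estimator 𝒳 𝒯 𝒵 n (codeSize γ n), h'.distortion PX PS W d) + (n : ℝ≥0∞)⁻¹ := by
    intro n
    by_cases htop : (⨅ h' : Estimator 𝒳 𝒯 𝒵 n (codeSize γ n), h'.distortion PX PS W d) = ⊤
    · exact ⟨Estimator.deterministic (e := fun _ => Fin.last _) measurable_const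
        (ψ := fun _ _ => z₀) measurable_const, by rw [htop, top_add]; exact le_top⟩
    · obtain ⟨h, hh⟩ := iInf_lt_iff.1 (ENNReal.lt_add_right htop
        (ENNReal.inv_ne_zero.2 (ENNReal.natCast_ne_top n)))
      exact ⟨h, hh.le⟩
  choose h hh using hpick
  refine ⟨h, ENNReal.le_of_forall_pos_le_add fun ε hε _ => ?_⟩
  have hε2 : 0 < ε / 2 := by positivity
  have hinv : ∀ᶠ n : ℕ in atTop, (n : ℝ≥0∞)⁻¹ < (ε / 2 : ℝ≥0) :=
    ENNReal.tendsto_inv_nat_nhds_zero.eventually_lt_const (by exact_mod_cast hε2)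
  refine limsup_le_of_le (h := ?_)
  filter_upwards [eventually_exists_estimator PX PS W hd hz₀ Q hQD hγ hε2, hinv] with n hn1 hn2
  obtain ⟨h', hh'⟩ := hn1
  calc (h n).distortion PX PS W d
      ≤ (⨅ h' : Estimator 𝒳 𝒯 𝒵 n (codeSize γ n), h'.distortion PX PS W d) + (n : ℝ≥0∞)⁻¹ := hh n
    _ ≤ (letterDistortion PX PS W d Q + (ε / 2 : ℝ≥0)) + (ε / 2 : ℝ≥0) :=
        add_le_add ((iInf_le _ h').trans hh') hn2.le
    _ = letterDistortion PX PS W d Q + ε := by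
        rw [add_assoc, ← ENNReal.coe_add, add_halves]

lemma tendsto_log_codeSize_div {γ : ℝ} (hγ : 0 ≤ γ) :
    Tendsto (fun n : ℕ => Real.log (codeSize γ n) / n) atTop (𝓝 γ) := by
  have hlow : ∀ n : ℕ, n * γ ≤ Real.log (codeSize γ n) := fun n => by
    rw [Real.le_log_iff_exp_le (by exact_mod_cast Nat.succ_pos _), codeSize]
    push_cast
    linarith [Nat.le_ceil (Real.exp (n * γ))]
  have hup : ∀ n : ℕ, Real.log (codeSize γ n) ≤ Real.log 3 + n * γ := fun n => by
    have h1 : (1 : ℝ) ≤ Real.exp (n * γ) := Real.one_le_exp (by positivity)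
    have h2 : (codeSize γ n : ℝ) ≤ 3 * Real.exp (n * γ) := by
      rw [codeSize]
      push_cast
      linarith [Nat.ceil_lt_add_one (Real.exp_pos (n * γ)).le]
    calc Real.log (codeSize γ n) ≤ Real.log (3 * Real.exp (n * γ)) :=
          Real.log_le_log (by exact_mod_cast Nat.succ_pos _) h2
      _ = _ := by rw [Real.log_mul (by norm_num) (Real.exp_pos _).ne', Real.log_exp]
  have hlim : Tendsto (fun n : ℕ => Real.log 3 / n + γ) atTop (𝓝 γ) := by
    simpa using (tendsto_const_div_atTop_nhds_zero_nat (Real.log 3)).add_const γ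
  refine tendsto_of_tendsto_of_tendsto_of_le_of_le' tendsto_const_nhds hlim ?_ ?_
  · filter_upwards [eventually_gt_atTop 0] with n hn
    rw [le_div_iff₀' (by exact_mod_cast hn)]
    exact hlow n
  · filter_upwards [eventually_gt_atTop 0] with n hn
    have hn' : (0 : ℝ) < n := by exact_mod_cast hn
    rw [div_le_iff₀ hn', add_mul, div_mul_cancel₀ _ hn'.ne']
    linarith [hup n]

end AchievabilityLimit

/-! ### Continuity of the single-letter rate -/

section Continuity

open InformationTheory

variable {𝒳 𝒮 𝒯 𝒵 : Type*} [MeasurableSpace 𝒳] [MeasurableSpace 𝒮] [MeasurableSpace 𝒯]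
  [MeasurableSpace 𝒵]
variable {PX : Measure 𝒳} {PS : Measure 𝒮} {W : Kernel (𝒳 × 𝒮) 𝒯} {d : 𝒮 → 𝒵 → ℝ≥0∞}

lemma exists_kernel_of_infoRate_lt {D r : ℝ≥0∞} (h : infoRate PX PS W d D < r) :
    ∃ Q : Kernel (𝒳 × 𝒯) 𝒵, IsMarkovKernel Q ∧ letterDistortion PX PS W d Q ≤ D ∧
      condMutualInfo PX PS W Q < r := by
  simp only [infoRate, iInf_lt_iff] at h
  obtain ⟨Q, hQ, hD, hr⟩ := h
  exact ⟨Q, hQ, hD, hr⟩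

lemma infoRate_eq_top_of_lt {D : ℝ≥0∞} (h : D < minDistortion PX PS W d) :
    infoRate PX PS W d D = ⊤ := by
  by_contra hne
  exact (sInf_le (show D ∈ {D | infoRate PX PS W d D ≠ ⊤} from hne)).not_gt h

lemma exists_lt_infoRate_ne_top {D : ℝ≥0} (h : minDistortion PX PS W d < D) :
    ∃ D₁ : ℝ≥0, D₁ < D ∧ infoRate PX PS W d D₁ ≠ ⊤ := by
  obtain ⟨D₁, hD₁, hlt⟩ := sInf_lt_iff.1 h
  lift D₁ to ℝ≥0 using (hlt.trans_le le_top).ne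
  exact ⟨D₁, by exact_mod_cast hlt, hD₁⟩

variable [IsProbabilityMeasure PX] [IsProbabilityMeasure PS] [IsMarkovKernel W]
  [StandardBorelSpace 𝒮] [Nonempty 𝒮] [StandardBorelSpace 𝒵] [Nonempty 𝒵]

lemma infoRate_convex (hd : Measurable (Function.uncurry d)) (D₁ D₂ : ℝ≥0∞) {a b : ℝ≥0}
    (ha : a ≠ 0) (hb : b ≠ 0) (hab : a + b = 1) :
    infoRate PX PS W d (a * D₁ + b * D₂) ≤
      a * infoRate PX PS W d D₁ + b * infoRate PX PS W d D₂ := by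
  have ha' : (a : ℝ≥0∞) ≠ 0 := by exact_mod_cast ha
  have hb' : (b : ℝ≥0∞) ≠ 0 := by exact_mod_cast hb
  by_cases h₁ : infoRate PX PS W d D₁ = ⊤
  · rw [h₁, ENNReal.mul_top ha', top_add]; exact le_top
  by_cases h₂ : infoRate PX PS W d D₂ = ⊤
  · rw [h₂, ENNReal.mul_top hb', add_top]; exact le_top
  refine ENNReal.le_of_forall_pos_le_add fun ε hε _ => ?_
  have hε' : (ε : ℝ≥0∞) ≠ 0 := by exact_mod_cast hε.ne'
  obtain ⟨Q₁, hQ₁, hD₁, hI₁⟩ := exists_kernel_of_infoRate_lt (ENNReal.lt_add_right h₁ hε')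
  obtain ⟨Q₂, hQ₂, hD₂, hI₂⟩ := exists_kernel_of_infoRate_lt (ENNReal.lt_add_right h₂ hε')
  set m := echoLaw PX PS W
  have hab' : (a : ℝ≥0∞) + b = 1 := by exact_mod_cast hab
  have hfst : (a • (m ⊗ₘ Q₁) + b • (m ⊗ₘ Q₂)).fst = m := by
    rw [Measure.fst, Measure.map_add _ _ measurable_fst, Measure.map_smul, Measure.map_smul,
      ← Measure.fst, ← Measure.fst, Measure.fst_compProd, Measure.fst_compProd, ← add_smul, hab,
      one_smul]
  have hdist : ∫⁻ p, echoDistortion PX PS W d p ∂(a • (m ⊗ₘ Q₁) + b • (m ⊗ₘ Q₂)) ≤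
      a * D₁ + b * D₂ := by
    rw [lintegral_add_measure, lintegral_smul_measure, lintegral_smul_measure,
      ← letterDistortion_eq PX PS W hd, ← letterDistortion_eq PX PS W hd, ENNReal.smul_def,
      ENNReal.smul_def, smul_eq_mul, smul_eq_mul]
    gcongr
  calc infoRate PX PS W d (a * D₁ + b * D₂)
      ≤ echoInfo PS W (a • (m ⊗ₘ Q₁) + b • (m ⊗ₘ Q₂)) := infoRate_le PX PS W hd hfst hdist
    _ ≤ a * echoInfo PS W (m ⊗ₘ Q₁) + b * echoInfo PS W (m ⊗ₘ Q₂) :=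
        echoInfo_convex PS W _ _ ha hb
    _ ≤ a * (infoRate PX PS W d D₁ + ε) + b * (infoRate PX PS W d D₂ + ε) := by
        rw [← condMutualInfo_eq, ← condMutualInfo_eq]
        gcongr
    _ = a * infoRate PX PS W d D₁ + b * infoRate PX PS W d D₂ + (a + b) * ε := by ring
    _ = _ := by rw [hab', one_mul]

/-- The chord from a point `D₁` of finite rate to a point `D₂ > D₁`, evaluated close to `D₂`. -/
lemma infoRate_chord_le (hd : Measurable (Function.uncurry d)) (D₁ D₂ : ℝ≥0) {t : ℝ≥0}
    (ht0 : t ≠ 0) (ht1 : t < 1) :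
    infoRate PX PS W d ((t * D₁ + (1 - t) * D₂ : ℝ≥0) : ℝ≥0∞) ≤
      t * infoRate PX PS W d D₁ + infoRate PX PS W d D₂ := by
  have h := infoRate_convex (PX := PX) (PS := PS) (W := W) hd D₁ D₂ ht0 (tsub_pos_of_lt ht1).ne'
    (add_tsub_cancel_of_le ht1.le)
  push_cast at h ⊢
  refine h.trans (add_le_add le_rfl (mul_le_of_le_one_left' ?_))
  exact tsub_le_self

lemma exists_lt_infoRate_lt (hd : Measurable (Function.uncurry d)) {D : ℝ≥0}
    (h : minDistortion PX PS W d < D) {r : ℝ≥0∞} (hr : infoRate PX PS W d D < r) :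
    ∃ D' : ℝ≥0, D' < D ∧ infoRate PX PS W d D' < r := by
  obtain ⟨D₁, hD₁, hfin⟩ := exists_lt_infoRate_ne_top h
  have hlim : Tendsto (fun t : ℝ≥0 => (t : ℝ≥0∞) * infoRate PX PS W d D₁ + infoRate PX PS W d D)
      (𝓝[>] 0) (𝓝 (infoRate PX PS W d D)) := by
    have h1 : Tendsto (fun t : ℝ≥0 => (t : ℝ≥0∞)) (𝓝[>] 0) (𝓝 0) := by
      have : Tendsto (fun t : ℝ≥0 => (t : ℝ≥0∞)) (𝓝 0) (𝓝 ((0 : ℝ≥0) : ℝ≥0∞)) :=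
        ENNReal.continuous_coe.tendsto 0
      simpa using this.mono_left nhdsWithin_le_nhds
    simpa using (ENNReal.Tendsto.mul_const h1 (Or.inr hfin)).add_const (infoRate PX PS W d D)
  have h1 : ∀ᶠ t : ℝ≥0 in 𝓝[>] 0, t < 1 :=
    nhdsWithin_le_nhds (Iio_mem_nhds zero_lt_one)
  obtain ⟨t, ht, ht1, ht0⟩ := ((hlim.eventually_lt_const hr).and
    (h1.and (self_mem_nhdsWithin : ∀ᶠ t : ℝ≥0 in 𝓝[>] 0, t ∈ Set.Ioi 0))).exists
  have ht0 : 0 < t := ht0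
  refine ⟨t * D₁ + (1 - t) * D, ?_, (infoRate_chord_le hd D₁ D ht0.ne' ht1).trans_lt ht⟩
  calc t * D₁ + (1 - t) * D < t * D + (1 - t) * D := by gcongr
    _ = D := by rw [← add_mul, add_tsub_cancel_of_le ht1.le, one_mul]

/-- Right continuity of the rate above `D_min`. -/
lemma infoRate_le_of_forall_add (hd : Measurable (Function.uncurry d)) {D : ℝ≥0}
    (h : minDistortion PX PS W d < D) {r : ℝ≥0∞}
    (hr : ∀ ε : ℝ≥0, 0 < ε → infoRate PX PS W d ((D + ε : ℝ≥0) : ℝ≥0∞) ≤ r) :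
    infoRate PX PS W d D ≤ r := by
  obtain ⟨D₁, hD₁, hfin⟩ := exists_lt_infoRate_ne_top h
  have hlim : Tendsto (fun t : ℝ≥0 => (t : ℝ≥0∞) * infoRate PX PS W d D₁ + r) (𝓝[>] 0) (𝓝 r) := by
    have h1 : Tendsto (fun t : ℝ≥0 => (t : ℝ≥0∞)) (𝓝[>] 0) (𝓝 0) := by
      have : Tendsto (fun t : ℝ≥0 => (t : ℝ≥0∞)) (𝓝 0) (𝓝 ((0 : ℝ≥0) : ℝ≥0∞)) :=
        ENNReal.continuous_coe.tendsto 0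
      simpa using this.mono_left nhdsWithin_le_nhds
    simpa using (ENNReal.Tendsto.mul_const h1 (Or.inr hfin)).add_const r
  have h1 : ∀ᶠ t : ℝ≥0 in 𝓝[>] 0, t < 1 :=
    nhdsWithin_le_nhds (Iio_mem_nhds zero_lt_one)
  refine ge_of_tendsto hlim ?_
  filter_upwards [h1, self_mem_nhdsWithin] with t ht1 ht0
  have ht0 : 0 < t := ht0
  have hs : 0 < 1 - t := tsub_pos_of_lt ht1
  -- `D` is the point of the chord from `D₁` to `D + ε` with weight `t` on `D₁`
  set ε : ℝ≥0 := t * (D - D₁) / (1 - t)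
  have hε : 0 < ε := div_pos (mul_pos ht0 (tsub_pos_of_lt hD₁)) hs
  have e : t * D₁ + (1 - t) * (D + ε) = D := by
    rw [mul_add, mul_div_cancel₀ _ hs.ne', mul_tsub, add_left_comm,
      add_tsub_cancel_of_le (by gcongr), ← add_mul, tsub_add_cancel_of_le ht1.le, one_mul]
  have := infoRate_chord_le (PX := PX) (PS := PS) (W := W) hd D₁ (D + ε) ht0.ne' ht1
  rw [e] at this
  exact this.trans (add_le_add le_rfl (hr ε hε))

end Continuity

/-! ### Finite alphabets -/

section FiniteAlphabets

open InformationTheory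

/-- Variational lower bound on the divergence from `μ ⊗ₘ η`. -/
lemma integral_le_toReal_klDiv {α β : Type*} [MeasurableSpace α] [MeasurableSpace β]
    {μ : Measure α} [IsProbabilityMeasure μ] {η : Kernel α β} [IsMarkovKernel η]
    {P : Measure (α × β)} [IsProbabilityMeasure P] (hP : P.fst = μ)
    (h : klDiv P (μ ⊗ₘ η) ≠ ⊤) {Y : α × β → ℝ} (mY : Measurable Y) (hY : Integrable Y P)
    (hY1 : ∀ a, ∫⁻ b, ENNReal.ofReal (Real.exp (Y (a, b))) ∂(η a) ≤ 1) :
    ∫ p, Y p ∂P ≤ (klDiv P (μ ⊗ₘ η)).toReal := by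
  obtain ⟨g, mg, hPg, -, hg0, hgi, hgI⟩ := exists_density_of_klDiv_ne_top hP h
  have mE : Measurable fun p => ENNReal.ofReal (Real.exp (Y p)) := by fun_prop
  have key : ∫⁻ p, ENNReal.ofReal (Real.exp (Y p - Real.log (g p).toReal)) ∂P ≤
      ENNReal.ofReal 1 := by
    calc ∫⁻ p, ENNReal.ofReal (Real.exp (Y p - Real.log (g p).toReal)) ∂P
        = ∫⁻ p, ENNReal.ofReal (Real.exp (Y p)) * (g p)⁻¹ ∂P := by
          refine lintegral_congr_ae ?_
          filter_upwards [hg0] with p hp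
          have hpos := ENNReal.toReal_pos hp.1 hp.2
          rw [Real.exp_sub, Real.exp_log hpos, ENNReal.ofReal_div_of_pos hpos,
            ENNReal.ofReal_toReal hp.2, div_eq_mul_inv]
      _ = ∫⁻ p, g p * (ENNReal.ofReal (Real.exp (Y p)) * (g p)⁻¹) ∂(μ ⊗ₘ η) := by
          conv_lhs => rw [hPg]
          exact lintegral_withDensity_eq_lintegral_mul _ mg (mE.mul mg.inv)
      _ ≤ ∫⁻ p, ENNReal.ofReal (Real.exp (Y p)) ∂(μ ⊗ₘ η) := by
          refine lintegral_mono fun p => ?_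
          rw [mul_left_comm]
          exact mul_le_of_le_one_right' (ENNReal.mul_inv_le_one _)
      _ = ∫⁻ a, ∫⁻ b, ENNReal.ofReal (Real.exp (Y (a, b))) ∂(η a) ∂μ :=
          Measure.lintegral_compProd mE
      _ ≤ ∫⁻ _, 1 ∂μ := lintegral_mono hY1
      _ = ENNReal.ofReal 1 := by simp
  have := integral_le_log_of_lintegral_exp_le (hY.sub hgi) zero_lt_one key
  rw [Real.log_one, integral_sub' hY hgi, hgI] at this
  linarith

/-- Sequential compactness of the probability measures on a finite space. -/
lemma exists_subseq_tendsto_measure {Ω : Type*} [MeasurableSpace Ω] [Finite Ω]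
    [MeasurableSingletonClass Ω] (P : ℕ → Measure Ω) [∀ k, IsProbabilityMeasure (P k)] :
    ∃ (Q : Measure Ω) (φ : ℕ → ℕ), IsProbabilityMeasure Q ∧ StrictMono φ ∧
      ∀ s, Tendsto (fun k => P (φ k) s) atTop (𝓝 (Q s)) := by
  have := Fintype.ofFinite Ω
  obtain ⟨p, -, φ, hφ, hp⟩ := (isCompact_Icc (a := (0 : Ω → ℝ)) (b := 1)).tendsto_subseq
    (x := fun k ω => (P k).real {ω}) fun k => ⟨fun ω => measureReal_nonneg,
      fun ω => measureReal_le_one⟩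
  set Q : Measure Ω := ∑ ω, ENNReal.ofReal (p ω) • Measure.dirac ω with hQ
  have hQs : ∀ s, Q s = ∑ ω, s.indicator (fun ω => ENNReal.ofReal (p ω)) ω := fun s => by
    rw [hQ, Measure.finsetSum_apply]
    refine Finset.sum_congr rfl fun ω _ => ?_
    rw [Measure.smul_apply, Measure.dirac_apply, smul_eq_mul]
    by_cases h : ω ∈ s <;> simp [h]
  have hPs : ∀ k s, P k s = ∑ ω, s.indicator (fun ω => ENNReal.ofReal ((P k).real {ω})) ω :=
    fun k s => by
      rw [← lintegral_indicator_one s.toFinite.measurableSet, lintegral_fintype]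
      refine Finset.sum_congr rfl fun ω _ => ?_
      by_cases h : ω ∈ s <;> simp [h]
  have hlim : ∀ s, Tendsto (fun k => P (φ k) s) atTop (𝓝 (Q s)) := fun s => by
    simp only [hPs, hQs]
    refine tendsto_finsetSum _ fun ω _ => ?_
    by_cases h : ω ∈ s
    · simp only [Set.indicator_of_mem h]
      exact ENNReal.tendsto_ofReal ((tendsto_pi_nhds.1 hp) ω)
    · simp only [Set.indicator_of_notMem h]
      exact tendsto_const_nhds
  refine ⟨Q, φ, ⟨?_⟩, hφ, hlim⟩
  exact tendsto_nhds_unique (hlim Set.univ) (by simp)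

lemma tendsto_integral_of_tendsto_measure {Ω : Type*} [MeasurableSpace Ω] [Finite Ω]
    [MeasurableSingletonClass Ω] {P : ℕ → Measure Ω} {Q : Measure Ω}
    [∀ k, IsProbabilityMeasure (P k)] [IsProbabilityMeasure Q]
    (h : ∀ s, Tendsto (fun k => P k s) atTop (𝓝 (Q s))) (Y : Ω → ℝ) :
    Tendsto (fun k => ∫ ω, Y ω ∂(P k)) atTop (𝓝 (∫ ω, Y ω ∂Q)) := by
  have := Fintype.ofFinite Ω
  simp only [integral_fintype (f := Y) Integrable.of_finite, smul_eq_mul]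
  refine tendsto_finsetSum _ fun ω _ => Tendsto.mul_const _ ?_
  exact (ENNReal.tendsto_toReal (measure_ne_top Q {ω})).comp (h {ω})

lemma lintegral_le_of_tendsto_measure {Ω : Type*} [MeasurableSpace Ω] [Finite Ω]
    [MeasurableSingletonClass Ω] {P : ℕ → Measure Ω} {Q : Measure Ω} [IsProbabilityMeasure Q]
    (h : ∀ s, Tendsto (fun k => P k s) atTop (𝓝 (Q s))) (F : Ω → ℝ≥0∞) {c : ℕ → ℝ≥0∞}
    {c₀ : ℝ≥0∞} (hc : Tendsto c atTop (𝓝 c₀)) (hF : ∀ k, ∫⁻ ω, F ω ∂(P k) ≤ c k) :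
    ∫⁻ ω, F ω ∂Q ≤ c₀ := by
  have := Fintype.ofFinite Ω
  have htrunc : ∀ N : ℕ, ∑ ω, min (F ω) N * Q {ω} ≤ c₀ := fun N => by
    have h1 : Tendsto (fun k => ∑ ω, min (F ω) N * P k {ω}) atTop (𝓝 (∑ ω, min (F ω) N * Q {ω})) :=
      tendsto_finsetSum _ fun ω _ => ENNReal.Tendsto.const_mul (h {ω})
        (Or.inr (ne_top_of_le_ne_top (ENNReal.natCast_ne_top N) (min_le_right _ _)))
    refine le_of_tendsto_of_tendsto' h1 hc fun k => le_trans ?_ (hF k)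
    rw [lintegral_fintype]
    gcongr
    exact min_le_left _ _
  have h2 : Tendsto (fun N : ℕ => ∑ ω, min (F ω) N * Q {ω}) atTop (𝓝 (∑ ω, F ω * Q {ω})) := by
    refine tendsto_finsetSum _ fun ω _ => ENNReal.Tendsto.mul_const ?_
      (Or.inr (measure_ne_top Q {ω}))
    have := (tendsto_const_nhds (x := F ω)).min ENNReal.tendsto_nat_nhds_top
    simpa using this
  rw [lintegral_fintype]
  exact le_of_tendsto' h2 htrunc

variable {𝒳 𝒮 𝒯 𝒵 : Type*} [MeasurableSpace 𝒳] [MeasurableSpace 𝒮] [MeasurableSpace 𝒯]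
  [MeasurableSpace 𝒵]
variable {PX : Measure 𝒳} {PS : Measure 𝒮} [IsProbabilityMeasure PS]
  {W : Kernel (𝒳 × 𝒮) 𝒯} [IsMarkovKernel W] {d : 𝒮 → 𝒵 → ℝ≥0∞}
  [Finite 𝒳] [Finite 𝒯] [Finite 𝒵] [MeasurableSingletonClass 𝒳] [MeasurableSingletonClass 𝒯]
  [MeasurableSingletonClass 𝒵]

lemma echoInfo_ne_top_of_finite {P : Measure ((𝒳 × 𝒯) × 𝒵)} [IsProbabilityMeasure P]
    (hP : P.fst = echoLaw PX PS W) : echoInfo PS W P ≠ ⊤ := by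
  refine klDiv_ne_top ?_ Integrable.of_finite
  have hsing : ∀ v : (𝒳 × 𝒵) × 𝒯, ((P.map swapEcho).fst ⊗ₘ (echoKernel PS W).prodMkRight 𝒵) {v} = 0 →
      (P.map swapEcho) {v} = 0 := by
    rintro ⟨⟨x, z⟩, t⟩ h0
    rw [← Set.singleton_prod_singleton, Measure.compProd_apply_prod (measurableSet_singleton _)
      (measurableSet_singleton _)] at h0
    rw [lintegral_singleton, Kernel.prodMkRight_apply, mul_eq_zero] at h0
    rcases h0 with h0 | h0
    · have e : P {((x, t), z)} ≤ (echoLaw PX PS W) {(x, t)} := by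
        rw [← hP, Measure.fst_apply (measurableSet_singleton _)]
        exact measure_mono (by rintro _ rfl; rfl)
      have e0 : (echoLaw PX PS W) {(x, t)} = 0 := by
        rw [echoLaw, ← Set.singleton_prod_singleton, Measure.compProd_apply_prod
          (measurableSet_singleton _) (measurableSet_singleton _), lintegral_singleton, h0, zero_mul]
      rw [Measure.map_apply measurable_swapEcho (measurableSet_singleton _)]
      refine measure_mono_null ?_ (le_antisymm (e.trans_eq e0) zero_le)
      rintro ⟨⟨x', t'⟩, z'⟩ hv
      simp only [swapEcho, Set.mem_preimage, Set.mem_singleton_iff, Prod.mk.injEq] at hv ⊢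
      tauto
    · rw [Measure.fst_apply (measurableSet_singleton _)] at h0
      exact measure_mono_null (by rintro _ rfl; rfl) h0
  refine Measure.AbsolutelyContinuous.mk fun s _ hs => ?_
  rw [← Set.biUnion_of_singleton s, measure_biUnion_null_iff s.to_countable]
  exact fun v hv => hsing v (measure_mono_null (Set.singleton_subset_iff.2 hv) hs)

/-- Lower semicontinuity of the information. The density `g` at the limit is replaced by
`(g + ε) / (1 + ε)`, whose logarithm is bounded below and hence has converging means. -/
lemma echoInfo_le_of_tendsto {P : ℕ → Measure ((𝒳 × 𝒯) × 𝒵)} {Q : Measure ((𝒳 × 𝒯) × 𝒵)}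
    [∀ k, IsProbabilityMeasure (P k)] [IsProbabilityMeasure Q]
    (hP : ∀ k, (P k).fst = echoLaw PX PS W) (hQ : Q.fst = echoLaw PX PS W)
    (h : ∀ s, Tendsto (fun k => P k s) atTop (𝓝 (Q s))) {c : ℕ → ℝ} {r : ℝ}
    (hc : Tendsto c atTop (𝓝 r)) (hPc : ∀ k, (echoInfo PS W (P k)).toReal ≤ c k) :
    (echoInfo PS W Q).toReal ≤ r := by
  set E := (echoKernel PS W).prodMkRight 𝒵
  have hmapP : ∀ k, IsProbabilityMeasure ((P k).map swapEcho) := fun k =>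
    Measure.isProbabilityMeasure_map measurable_swapEcho.aemeasurable
  have hmapQ : IsProbabilityMeasure (Q.map swapEcho) :=
    Measure.isProbabilityMeasure_map measurable_swapEcho.aemeasurable
  have hmap : ∀ s, Tendsto (fun k => ((P k).map swapEcho) s) atTop (𝓝 ((Q.map swapEcho) s)) :=
    fun s => by
      simp only [Measure.map_apply measurable_swapEcho s.toFinite.measurableSet]
      exact h _
  obtain ⟨g, mg, -, hg1, hg0, -, hgI⟩ := exists_density_of_klDiv_ne_top rfl
    (echoInfo_ne_top_of_finite hQ)
  change _ = (echoInfo PS W Q).toReal at hgI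
  rw [← hgI]
  have hmain : ∀ ε : ℝ, 0 < ε →
      ∫ p, Real.log (g p).toReal ∂(Q.map swapEcho) ≤ r + Real.log (1 + ε) := fun ε hε => by
    set Y : (𝒳 × 𝒵) × 𝒯 → ℝ := fun p => Real.log (((g p).toReal + ε) / (1 + ε)) with hY
    have mY : Measurable Y := measurable_of_finite Y
    have hpos : ∀ p, 0 < (g p).toReal + ε := fun p =>
      add_pos_of_nonneg_of_pos ENNReal.toReal_nonneg hε
    have hexp : ∀ a, ∫⁻ b, ENNReal.ofReal (Real.exp (Y (a, b))) ∂(E a) ≤ 1 := fun a => by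
      have e1 : ∀ b, ENNReal.ofReal (Real.exp (Y (a, b))) ≤
          (g (a, b) + ENNReal.ofReal ε) * (ENNReal.ofReal (1 + ε))⁻¹ := fun b => by
        rw [hY]
        simp only
        rw [Real.exp_log (by have := hpos (a, b); positivity),
          ENNReal.ofReal_div_of_pos (by positivity), ENNReal.ofReal_add ENNReal.toReal_nonneg hε.le,
          div_eq_mul_inv]
        gcongr
        exact ENNReal.ofReal_toReal_le
      refine (lintegral_mono e1).trans ?_
      rw [lintegral_mul_const _ (by fun_prop), lintegral_add_right _ measurable_const,
        lintegral_const, measure_univ, mul_one]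
      calc _ ≤ (1 + ENNReal.ofReal ε) * (ENNReal.ofReal (1 + ε))⁻¹ := by
            gcongr; exact hg1 a
        _ = ENNReal.ofReal (1 + ε) * (ENNReal.ofReal (1 + ε))⁻¹ := by
            rw [ENNReal.ofReal_add zero_le_one hε.le, ENNReal.ofReal_one]
        _ ≤ 1 := (ENNReal.mul_inv_le_one _)
    have hk : ∀ k, ∫ p, Y p ∂((P k).map swapEcho) ≤ c k := fun k =>
      (integral_le_toReal_klDiv rfl (echoInfo_ne_top_of_finite (hP k)) mY
        Integrable.of_finite hexp).trans (hPc k)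
    have hlim : ∫ p, Y p ∂(Q.map swapEcho) ≤ r :=
      le_of_tendsto_of_tendsto' (tendsto_integral_of_tendsto_measure hmap Y) hc hk
    calc ∫ p, Real.log (g p).toReal ∂(Q.map swapEcho)
        ≤ ∫ p, (Y p + Real.log (1 + ε)) ∂(Q.map swapEcho) := by
          refine integral_mono_ae Integrable.of_finite Integrable.of_finite ?_
          filter_upwards [hg0] with p hp
          rw [hY]
          simp only
          rw [Real.log_div (hpos p).ne' (by positivity), sub_add_cancel]
          exact Real.log_le_log (ENNReal.toReal_pos hp.1 hp.2) (by linarith)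
      _ = ∫ p, Y p ∂(Q.map swapEcho) + Real.log (1 + ε) := by
          rw [integral_add Integrable.of_finite (integrable_const _)]; simp
      _ ≤ r + Real.log (1 + ε) := by gcongr
  have hlim : Tendsto (fun ε : ℝ => r + Real.log (1 + ε)) (𝓝[>] 0) (𝓝 r) := by
    have : Tendsto (fun ε : ℝ => r + Real.log (1 + ε)) (𝓝 0) (𝓝 (r + Real.log (1 + 0))) := by
      have h1 : ContinuousAt (fun ε : ℝ => r + Real.log (1 + ε)) 0 :=
        continuousAt_const.add ((continuousAt_const.add continuousAt_id).log (by simp))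
      exact h1
    simpa using this.mono_left nhdsWithin_le_nhds
  refine ge_of_tendsto hlim ?_
  filter_upwards [self_mem_nhdsWithin] with ε hε
  exact hmain ε hε

variable [IsProbabilityMeasure PX]

/-- For finite alphabets the rate is right continuous everywhere. -/
lemma infoRate_le_of_forall_add_of_finite [StandardBorelSpace 𝒮] [Nonempty 𝒮]
    [StandardBorelSpace 𝒵] [Nonempty 𝒵] (hd : Measurable (Function.uncurry d)) {D r : ℝ≥0}
    (hr : ∀ ε : ℝ≥0, 0 < ε → infoRate PX PS W d ((D + ε : ℝ≥0) : ℝ≥0∞) ≤ r) :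
    infoRate PX PS W d D ≤ r := by
  obtain ⟨u, -, hu0, hu⟩ := exists_seq_strictAnti_tendsto (0 : ℝ≥0)
  have hex : ∀ k, ∃ Q : Kernel (𝒳 × 𝒯) 𝒵, IsMarkovKernel Q ∧
      letterDistortion PX PS W d Q ≤ ((D + u k : ℝ≥0) : ℝ≥0∞) ∧
      condMutualInfo PX PS W Q < ((r + u k : ℝ≥0) : ℝ≥0∞) := fun k =>
    exists_kernel_of_infoRate_lt ((hr (u k) (hu0 k)).trans_lt (by
      exact_mod_cast lt_add_of_pos_right r (hu0 k)))
  choose Q hQ hQD hQI using hex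
  obtain ⟨P, φ, hP, hφ, hlim⟩ := exists_subseq_tendsto_measure fun k => echoLaw PX PS W ⊗ₘ Q k
  have huφ := hu.comp hφ.tendsto_atTop
  have hfst : P.fst = echoLaw PX PS W := by
    ext s hs
    rw [Measure.fst_apply hs]
    refine tendsto_nhds_unique (hlim (Prod.fst ⁻¹' s)) ?_
    simp_rw [← Measure.fst_apply hs, Measure.fst_compProd]
    exact tendsto_const_nhds
  have hD : ∫⁻ p, echoDistortion PX PS W d p ∂P ≤ D := by
    refine lintegral_le_of_tendsto_measure hlim _ (c := fun k => ((D + u (φ k) : ℝ≥0) : ℝ≥0∞)) ?_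
      fun k => ?_
    · refine ENNReal.tendsto_coe.2 ?_
      simpa using huφ.const_add D
    · rw [← letterDistortion_eq PX PS W hd]; exact hQD (φ k)
  have hI : (echoInfo PS W P).toReal ≤ r := by
    refine echoInfo_le_of_tendsto (c := fun k => ((r + u (φ k) : ℝ≥0) : ℝ))
      (fun k => Measure.fst_compProd _ (Q (φ k))) hfst hlim ?_ fun k => ?_
    · refine NNReal.tendsto_coe.2 ?_
      simpa using huφ.const_add r
    · rw [← condMutualInfo_eq]
      exact ENNReal.toReal_mono ENNReal.coe_ne_top (hQI (φ k)).le
  refine (infoRate_le PX PS W hd hfst hD).trans ?_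
  rw [← ENNReal.ofReal_toReal (echoInfo_ne_top_of_finite hfst), ← ENNReal.ofReal_coe_nnreal]
  exact ENNReal.ofReal_le_ofReal hI

end FiniteAlphabets

/-! ### Operational rates -/

section OperationalRates

variable {𝒳 𝒮 𝒯 𝒵 : Type*} [MeasurableSpace 𝒳] [MeasurableSpace 𝒮] [MeasurableSpace 𝒯]
  [MeasurableSpace 𝒵]

lemma Estimator.card_ne_zero [Nonempty 𝒳] [Nonempty 𝒯] {n K : ℕ} (h : Estimator 𝒳 𝒯 𝒵 n K) :
    K ≠ 0 := by
  rintro rfl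
  have h1 := measure_univ
    (μ := h.enc (fun _ => Classical.arbitrary 𝒳, fun _ => Classical.arbitrary 𝒯))
  rw [Set.univ_eq_empty_iff.2 inferInstance, measure_empty] at h1
  exact zero_ne_one h1

lemma indexRate_natCast {n K : ℕ} (hK : K ≠ 0) :
    indexRate n K = ((Real.log K / n : ℝ) : EReal) := by
  have h : ((K : ℕ∞) : ℝ≥0∞) = (K : ℝ≥0∞) := by simp
  rw [indexRate, h, ENNReal.log_pos_real (by exact_mod_cast hK) (ENNReal.natCast_ne_top K),
    ENNReal.toReal_natCast, EReal.coe_div, EReal.coe_natCast]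

lemma indexRate_mono (n : ℕ) {K L : ℕ∞} (h : K ≤ L) : indexRate n K ≤ indexRate n L :=
  EReal.div_le_div_right_of_nonneg (by exact_mod_cast n.zero_le)
    (ENNReal.log_monotone (by exact_mod_cast h))

lemma indexRate_top {n : ℕ} (hn : n ≠ 0) : indexRate n ⊤ = ⊤ := by
  rw [indexRate, ENat.toENNReal_top, ENNReal.log_top]
  exact EReal.top_div_of_pos_ne_top (by exact_mod_cast Nat.pos_of_ne_zero hn)
    (by rw [← EReal.coe_natCast]; exact EReal.coe_ne_top _)

lemma tendsto_indexRate_codeSize {γ : ℝ} (hγ : 0 ≤ γ) :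
    Tendsto (fun n => indexRate n (codeSize γ n)) atTop (𝓝 (γ : EReal)) := by
  simp_rw [fun n => indexRate_natCast (n := n) (K := codeSize γ n) (Nat.succ_ne_zero _)]
  exact (continuous_coe_real_ereal.tendsto γ).comp (tendsto_log_codeSize_div hγ)

variable {PX : Measure 𝒳} [IsProbabilityMeasure PX] {PS : Measure 𝒮} [IsProbabilityMeasure PS]
  {W : Kernel (𝒳 × 𝒮) 𝒯} [IsMarkovKernel W] {d : 𝒮 → 𝒵 → ℝ≥0∞}
  [StandardBorelSpace 𝒮] [Nonempty 𝒮] [StandardBorelSpace 𝒵] [Nonempty 𝒵]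

section Converse

variable [StandardBorelSpace 𝒯] [Nonempty 𝒳] [Nonempty 𝒯]

lemma infoRate_le_indexRate (hd : Measurable (Function.uncurry d)) {n K : ℕ} (hn : n ≠ 0)
    (h : Estimator 𝒳 𝒯 𝒵 n K) {D : ℝ≥0∞} (hD : h.distortion PX PS W d ≤ D) :
    (infoRate PX PS W d D : EReal) ≤ indexRate n K := by
  rw [indexRate_natCast h.card_ne_zero]
  have h1 := h.infoRate_distortion_le PX PS W hd hn h.card_ne_zero hD
  have h0 : 0 ≤ Real.log K / n := div_nonneg (Real.log_natCast_nonneg K) n.cast_nonneg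
  calc (infoRate PX PS W d D : EReal) ≤ (ENNReal.ofReal (Real.log K / n) : EReal) := by
        exact_mod_cast h1
    _ = _ := by rw [EReal.coe_ennreal_ofReal, max_eq_left h0]

lemma infoRate_le_indexRate_minIndices (hd : Measurable (Function.uncurry d)) {n : ℕ}
    (hn : n ≠ 0) (D : ℝ≥0∞) :
    (infoRate PX PS W d D : EReal) ≤ indexRate n (minIndices PX PS W d n D) := by
  by_cases htop : minIndices PX PS W d n D = ⊤
  · rw [htop, indexRate_top hn]; exact le_top
  · obtain ⟨K, hK⟩ := ENat.ne_top_iff_exists.1 htop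
    have hlt : minIndices PX PS W d n D < (K + 1 : ℕ) := by
      rw [← hK]; exact_mod_cast Nat.lt_succ_self K
    simp only [minIndices, iInf_lt_iff] at hlt
    obtain ⟨L, ⟨h, hh⟩, hL⟩ := hlt
    have hLK : (L : ℕ∞) ≤ K := by
      exact_mod_cast Nat.lt_succ_iff.1 (by exact_mod_cast hL : L < K + 1)
    exact (infoRate_le_indexRate hd hn h hh).trans (indexRate_mono n (hLK.trans_eq hK))

lemma infoRate_le_limsup_indexRate (hd : Measurable (Function.uncurry d)) {D : ℝ≥0}
    (hcont : ∀ r : ℝ≥0, (∀ ε : ℝ≥0, 0 < ε → infoRate PX PS W d ((D + ε : ℝ≥0) : ℝ≥0∞) ≤ r) →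
      infoRate PX PS W d D ≤ r)
    {K : ℕ → ℕ} (h : ∀ n, Estimator 𝒳 𝒯 𝒵 n (K n))
    (hD : limsup (fun n => (h n).distortion PX PS W d) atTop ≤ D) :
    (infoRate PX PS W d D : EReal) ≤ limsup (fun n => indexRate n (K n)) atTop := by
  refine le_of_forall_gt_imp_ge_of_dense fun a ha => ?_
  obtain ⟨c, hc1, hc2⟩ := EReal.lt_iff_exists_real_btwn.1 ha
  have hev : ∀ᶠ n in atTop, indexRate n (K n) < c := eventually_lt_of_limsup_lt hc1
  have hstep : ∀ ε : ℝ≥0, 0 < ε →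
      (infoRate PX PS W d ((D + ε : ℝ≥0) : ℝ≥0∞) : EReal) < c := fun ε hε => by
    have hlt : limsup (fun n => (h n).distortion PX PS W d) atTop < ((D + ε : ℝ≥0) : ℝ≥0∞) :=
      hD.trans_lt (by exact_mod_cast lt_add_of_pos_right D hε)
    obtain ⟨n, hn1, hn2, hn3⟩ := (hev.and ((eventually_lt_of_limsup_lt hlt).and
      (eventually_ne_atTop 0))).exists
    exact (infoRate_le_indexRate hd hn3 (h n) hn2.le).trans_lt hn1
  have hc0 : 0 ≤ c := by
    have : ((0 : ℝ) : EReal) ≤ c :=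
      (EReal.coe_ennreal_nonneg _).trans (hstep 1 zero_lt_one).le
    exact_mod_cast this
  have hcoe : ((c.toNNReal : ℝ≥0∞) : EReal) = c := by
    change ((ENNReal.ofReal c : ℝ≥0∞) : EReal) = c
    rw [EReal.coe_ennreal_ofReal, max_eq_left hc0]
  have := hcont c.toNNReal fun ε hε => by
    have := (hstep ε hε).le
    rw [← hcoe] at this
    exact_mod_cast this
  calc (infoRate PX PS W d D : EReal) ≤ ((c.toNNReal : ℝ≥0∞) : EReal) := by exact_mod_cast this
    _ = c := hcoe
    _ ≤ a := hc2.le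

end Converse

/-- A real rate strictly between `R_I(D)` and a larger extended rate. -/
lemma exists_real_rate_between {R : ℝ≥0∞} {b : EReal} (h : (R : EReal) < b) :
    ∃ γ : ℝ, 0 ≤ γ ∧ R < ENNReal.ofReal γ ∧ (γ : EReal) < b := by
  obtain ⟨γ, h1, h2⟩ := EReal.lt_iff_exists_real_btwn.1 h
  have hγ : 0 ≤ γ := by
    have : ((0 : ℝ) : EReal) ≤ γ := (EReal.coe_ennreal_nonneg R).trans h1.le
    exact_mod_cast this
  refine ⟨γ, hγ, ?_, h2⟩
  have e : ((ENNReal.ofReal γ : ℝ≥0∞) : EReal) = γ := by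
    rw [EReal.coe_ennreal_ofReal, max_eq_left hγ]
  rw [← e] at h1
  exact_mod_cast h1

lemma asymptoticRate_le (hd : Measurable (Function.uncurry d))
    {z₀ : 𝒵} (hz₀ : ∫⁻ s, d s z₀ ∂PS ≠ ⊤) (D : ℝ≥0) :
    asymptoticRate PX PS W d D ≤ infoRate PX PS W d D := by
  refine le_of_forall_gt_imp_ge_of_dense fun b hb => ?_
  obtain ⟨γ, hγ0, hγ, hγb⟩ := exists_real_rate_between hb
  obtain ⟨Q, hQ, hQD, hQI⟩ := exists_kernel_of_infoRate_lt hγ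
  obtain ⟨h, hh⟩ := exists_estimator_seq PX PS W hd hz₀ Q
    (ne_top_of_le_ne_top ENNReal.coe_ne_top hQD) hQI
  have hle : asymptoticRate PX PS W d D ≤ limsup (fun n => indexRate n (codeSize γ n)) atTop :=
    sInf_le ⟨codeSize γ, h, hh.trans hQD, rfl⟩
  rw [(tendsto_indexRate_codeSize hγ0).limsup_eq] at hle
  exact hle.trans hγb.le

lemma eventually_indexRate_minIndices_lt (hd : Measurable (Function.uncurry d))
    {z₀ : 𝒵} (hz₀ : ∫⁻ s, d s z₀ ∂PS ≠ ⊤) {D : ℝ≥0} (hD : minDistortion PX PS W d < D)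
    {b : EReal} (hb : (infoRate PX PS W d D : EReal) < b) :
    ∀ᶠ n in atTop, indexRate n (minIndices PX PS W d n D) < b := by
  obtain ⟨γ, hγ0, hγ, hγb⟩ := exists_real_rate_between hb
  -- the slack `D - D'` absorbs the vanishing excess distortion of the codes
  obtain ⟨D', hD', hI⟩ := exists_lt_infoRate_lt hd hD hγ
  obtain ⟨Q, hQ, hQD, hQI⟩ := exists_kernel_of_infoRate_lt hI
  obtain ⟨h, hh⟩ := exists_estimator_seq PX PS W hd hz₀ Q
    (ne_top_of_le_ne_top ENNReal.coe_ne_top hQD) hQI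
  have hlt : limsup (fun n => (h n).distortion PX PS W d) atTop < D :=
    (hh.trans hQD).trans_lt (by exact_mod_cast hD')
  filter_upwards [eventually_lt_of_limsup_lt hlt,
    (tendsto_indexRate_codeSize hγ0).eventually_lt_const hγb] with n hn1 hn2
  refine (indexRate_mono n ?_).trans_lt hn2
  exact iInf₂_le (codeSize γ n) ⟨h n, hn1.le⟩

end OperationalRates

end StateSensing

end

theorem theorem1 {𝒳 𝒮 𝒯 𝒵 : Type*}
    [MeasurableSpace 𝒳] [StandardBorelSpace 𝒳] [MeasurableSpace 𝒮] [StandardBorelSpace 𝒮]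
    [MeasurableSpace 𝒯] [StandardBorelSpace 𝒯] [MeasurableSpace 𝒵] [StandardBorelSpace 𝒵]
    (PX : Measure 𝒳) [IsProbabilityMeasure PX] (PS : Measure 𝒮) [IsProbabilityMeasure PS]
    (W : Kernel (𝒳 × 𝒮) 𝒯) [IsMarkovKernel W]
    (d : 𝒮 → 𝒵 → ℝ≥0∞) (hd : Measurable (Function.uncurry d))
    (href : ∃ z₀ : 𝒵, ∫⁻ s, d s z₀ ∂PS ≠ ⊤) (D : ℝ≥0) :
    ((D : ℝ≥0∞) ≠ StateSensing.minDistortion PX PS W d →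
      Tendsto (fun n : ℕ => StateSensing.indexRate n (StateSensing.minIndices PX PS W d n D))
        atTop (𝓝 (StateSensing.infoRate PX PS W d D : EReal))) ∧
    ((D : ℝ≥0∞) ≠ StateSensing.minDistortion PX PS W d ∨
        (Finite 𝒳 ∧ Finite 𝒯 ∧ Finite 𝒵) →
      StateSensing.asymptoticRate PX PS W d D = (StateSensing.infoRate PX PS W d D : EReal)) := by
  obtain ⟨z₀, hz₀⟩ := href
  have : Nonempty 𝒵 := ⟨z₀⟩
  have : Nonempty 𝒳 := nonempty_of_isProbabilityMeasure PX
  have : Nonempty 𝒮 := nonempty_of_isProbabilityMeasure PS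
  have : Nonempty 𝒯 := nonempty_of_isProbabilityMeasure
    (W (Classical.arbitrary 𝒳, Classical.arbitrary 𝒮))
  refine ⟨fun hD => ?_, fun hD => ?_⟩
  · refine tendsto_order.2 ⟨fun a ha => ?_, fun b hb => ?_⟩
    · filter_upwards [eventually_ne_atTop 0] with n hn
      exact ha.trans_le (StateSensing.infoRate_le_indexRate_minIndices hd hn D)
    · rcases hD.lt_or_gt with hlt | hgt
      · rw [StateSensing.infoRate_eq_top_of_lt hlt] at hb
        exact absurd hb not_top_lt
      · exact StateSensing.eventually_indexRate_minIndices_lt hd hz₀ hgt hb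
  · refine le_antisymm (StateSensing.asymptoticRate_le hd hz₀ D) (le_sInf ?_)
    rintro _ ⟨K, h, hlim, rfl⟩
    refine StateSensing.infoRate_le_limsup_indexRate hd (fun r hr => ?_) h hlim
    rcases hD with hD | ⟨h𝒳, h𝒯, h𝒵⟩
    · rcases hD.lt_or_gt with hlt | hgt
      · obtain ⟨ε, hε, hlt'⟩ := ENNReal.lt_iff_exists_add_pos_lt.1 hlt
        have := hr ε hε
        rw [StateSensing.infoRate_eq_top_of_lt (by exact_mod_cast hlt')] at this
        exact absurd this (not_le.2 ENNReal.coe_lt_top)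
      · exact StateSensing.infoRate_le_of_forall_add hd hgt hr
    · exact StateSensing.infoRate_le_of_forall_add_of_finite hd hr
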